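/- Let $p\ge 0$ be an integer, $a\le b$ real numbers, $d_{\max}\ge 1$ an integer, and $\Lambda\subset\mathbb R^{4p+4}$. Write $\lambda=(\phi_1,\alpha_1,\phi_2,\alpha_2)$ with $\phi_i=(\phi_{i0},\dots,\phi_{ip})$ and $\alpha_i=(\alpha_{i0},\dots,\alpha_{ip})$, write $\theta=(\lambda,r_L,r_U,d)$, and let $$\Theta=\{(\lambda,r_L,r_U,d):\lambda\in\Lambda,\ a\le r_L\le r_U\le b,\ d\in\{1,\dots,d_{\max}\}\}.$$ For a sequence $(y_t)_{t\in\mathbb Z}$ put $\mu_{it}(\theta)=\phi_{i0}+\sum_{j=1}^p\phi_{ij}y_{t-j}$ and $h_{it}(\theta)=\alpha_{i0}+\sum_{j=1}^p\alpha_{ij}y_{t-j}^2$, $i=1,2$. Let $\theta_0=(\lambda_0,r_{0L},r_{0U},d_0)\in\Theta$, and let $(y_t)_{t\in\mathbb Z}$ follow the buffered double autoregressive model with parameter $\theta_0$: almost surely, for all $t\in\mathbb Z$, $$y_t=\begin{cases}\mu_{1t}(\theta_0)+\varepsilon_t\sqrt{h_{1t}(\theta_0)},&R_t=1,\\ \mu_{2t}(\theta_0)+\varepsilon_t\sqrt{h_{2t}(\theta_0)},&R_t=0,\end{cases}\qquad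 R_t=\begin{cases}1,&y_{t-d_0}\le r_{0L},\\0,&y_{t-d_0}>r_{0U},\\R_{t-1},&\text{otherwise,}\end{cases}$$ with $R_t\in\{0,1\}$ and each $\varepsilon_t$ independent of $(y_s)_{s<t}$. Given $y_{1-\max(p,d_{\max})},\dots,y_n$ and $\theta\in\Theta$, let $\widetilde R_0=1$ and, for $1\le t\le n$, let $\widetilde R_t=\widetilde R_t(r_L,r_U,d)$ be $1$ if $y_{t-d}\le r_L$, $0$ if $y_{t-d}>r_U$, and $\widetilde R_{t-1}$ otherwise (so observations whose regime cannot be identified are assigned to the lower regime). Put $$\widetilde L_n(\theta)=\sum_{t=1}^n\Bigl(\log\widetilde h_t(\theta)+\frac{(y_t-\widetilde\mu_t(\theta))^2}{\widetilde h_t(\theta)}\Bigr),$$ where $\widetilde\mu_t=\mu_{1t},\ \widetilde h_t=h_{1t}$ if $\widetilde R_t=1$, and $\widetilde\mu_t=\mu_{2t},\ \widetilde h_t=h_{2t}$ if $\widetilde R_t=0$. A Gaussian QMLE is any $\hat\theta_n\in\arg\min_{\theta\in\Theta}\widetilde L_n(\theta)$. Assume: 1. $\Pr(y_t\in[a,b])<1$,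 and the $\varepsilon_t$ are i.i.d. with mean zero, variance one, and a positive continuous density on $\mathbb R$; 2. $\Lambda$ is compact, and every $\lambda\in\Lambda$ satisfies $\phi_1\ne\phi_2$ and $\alpha_1\neq\alpha_2$, with all entries of $\alpha_1$ and $\alpha_2$ positive; 3. $(y_t)$ is strictly stationary and ergodic, with $E y_t^2<\infty$. Then, for every choice of the Gaussian QMLE, $\hat\theta_n=(\hat\lambda_n,\hat r_L,\hat r_U,\hat d)\to\theta_0$ almost surely as $n\to\infty$. -/

import Mathlib

open MeasureTheory ProbabilityTheory Filter Topology

namespace BDAR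

/-- Coefficients `(φ, α)` of one regime: `φ = (φ₀, …, φₚ)` and `α = (α₀, …, αₚ)`. -/
abbrev RegimeCoef (p : ℕ) : Type := (Fin (p + 1) → ℝ) × (Fin (p + 1) → ℝ)

/-- All coefficients: `((φ₁, α₁), (φ₂, α₂))`, that is, a point of `ℝ^(4p+4)`. -/
abbrev Coef (p : ℕ) : Type := RegimeCoef p × RegimeCoef p

/-- The full parameter vector: the coefficients, the two buffer boundaries `r_L`, `r_U`,
and the integer delay `d`, with the product topology (discrete in `d`). -/
abbrev Param (p : ℕ) : Type := Coef p × ℝ × ℝ × ℕ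

namespace Param

variable {p : ℕ}

/-- The coefficient vector of the full parameter. -/
def coef (θ : Param p) : Coef p := θ.1

/-- Lower boundary of the buffer zone. -/
def rL (θ : Param p) : ℝ := θ.2.1

/-- Upper boundary of the buffer zone. -/
def rU (θ : Param p) : ℝ := θ.2.2.1

/-- The delay. -/
def delay (θ : Param p) : ℕ := θ.2.2.2

/-- The regime coefficients in force when the regime indicator is `R`
(`true` stands for the value one, the lower regime; `false` for zero, the upper regime). -/
def regime (θ : Param p) (R : Bool) : RegimeCoef p := if R then θ.coef.1 else θ.coef.2

end Param

/-- The linear form `φ₀ + ∑ φᵢ y_{t-i}`, with `i` from `1` to `p`. -/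
def linMean {p : ℕ} (φ : Fin (p + 1) → ℝ) (y : ℤ → ℝ) (t : ℤ) : ℝ :=
  φ 0 + ∑ i : Fin p, φ i.succ * y (t - ((i : ℤ) + 1))

/-- The form `α₀ + ∑ αⱼ y_{t-j}²`, with `j` from `1` to `p`. -/
def quadVar {p : ℕ} (α : Fin (p + 1) → ℝ) (y : ℤ → ℝ) (t : ℤ) : ℝ :=
  α 0 + ∑ j : Fin p, α j.succ * y (t - ((j : ℤ) + 1)) ^ 2

/-- Conditional mean at time `t` when the regime indicator equals `R`. -/
def condMean {p : ℕ} (θ : Param p) (R : Bool) (y : ℤ → ℝ) (t : ℤ) : ℝ :=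
  linMean (θ.regime R).1 y t

/-- Conditional variance at time `t` when the regime indicator equals `R`. -/
def condVar {p : ℕ} (θ : Param p) (R : Bool) (y : ℤ → ℝ) (t : ℤ) : ℝ :=
  quadVar (θ.regime R).2 y t

/-- One step of the buffered regime switch: with threshold variable `x` and previous
indicator `R`, the new indicator is one if `x ≤ r_L`, zero if `x > r_U`, and `R` otherwise. -/
noncomputable def switch (rL rU x : ℝ) (R : Bool) : Bool :=
  if x ≤ rL then true else if rU < x then false else R

/-- The process `y` on the probability space `(Ω, P)` follows the buffered double
autoregressive model of order `p` with parameter `θ`, innovations `ε` and regime indicators `R`.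
The innovation at time `t` is independent of the past of `y`. -/
structure IsModel {Ω : Type*} [MeasurableSpace Ω] (P : Measure Ω) {p : ℕ} (θ : Param p)
    (y ε : ℤ → Ω → ℝ) (R : ℤ → Ω → Bool) : Prop where
  measurable_y : ∀ t, Measurable (y t)
  measurable_innov : ∀ t, Measurable (ε t)
  indep_past : ∀ t : ℤ, IndepFun (ε t) (fun ω (s : Set.Iio t) => y s ω) P
  regime_eq : ∀ t, ∀ᵐ ω ∂P,
    R t ω = switch θ.rL θ.rU (y (t - (θ.delay : ℤ)) ω) (R (t - 1) ω)
  obs_eq : ∀ t, ∀ᵐ ω ∂P,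
    y t ω = condMean θ (R t ω) (fun s => y s ω) t
      + ε t ω * √(condVar θ (R t ω) (fun s => y s ω) t)

/-- The innovations are independent and identically distributed with mean zero, variance one,
and a positive continuous density on the real line. -/
structure IsInnovation {Ω : Type*} [MeasurableSpace Ω] (P : Measure Ω)
    (ε : ℤ → Ω → ℝ) : Prop where
  indep : iIndepFun ε P
  memLp : ∀ t, MemLp (ε t) 2 P
  mean : ∀ t, ∫ ω, ε t ω ∂P = 0
  variance : ∀ t, Var[ε t; P] = 1
  density : ∃ f : ℝ → ℝ, Continuous f ∧ (∀ x, 0 < f x) ∧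
    ∀ t, P.map (ε t) = (volume : Measure ℝ).withDensity (fun x => ENNReal.ofReal (f x))

/-- The left shift on two-sided real sequences. -/
def shift (x : ℤ → ℝ) : ℤ → ℝ := fun t => x (t + 1)

/-- Law of the process `y` on the space of two-sided real sequences. -/
noncomputable def pathLaw {Ω : Type*} [MeasurableSpace Ω] (P : Measure Ω)
    (y : ℤ → Ω → ℝ) : Measure (ℤ → ℝ) :=
  P.map (fun ω t => y t ω)

/-- Strict stationarity: the law of the process is invariant under the shift. -/
def StrictlyStationary {Ω : Type*} [MeasurableSpace Ω] (P : Measure Ω)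
    (y : ℤ → Ω → ℝ) : Prop :=
  MeasurePreserving shift (pathLaw P y) (pathLaw P y)

/-- Ergodicity: shift-invariant events have probability zero or one. -/
def IsErgodic {Ω : Type*} [MeasurableSpace Ω] (P : Measure Ω)
    (y : ℤ → Ω → ℝ) : Prop :=
  PreErgodic shift (pathLaw P y)

/-- The parameter space: coefficients in `Λ`, boundaries `a ≤ r_L ≤ r_U ≤ b`, and
delay in `{1, …, dmax}`. -/
def paramSpace {p : ℕ} (Λ : Set (Coef p)) (a b : ℝ) (dmax : ℕ) : Set (Param p) :=
  {θ | θ.coef ∈ Λ ∧ a ≤ θ.rL ∧ θ.rL ≤ θ.rU ∧ θ.rU ≤ b ∧ 1 ≤ θ.delay ∧ θ.delay ≤ dmax}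

/-- The regime indicators computed from the sample. As long as the threshold variables from time
`1` on have stayed in the buffer zone, the lower regime is assigned. -/
noncomputable def sampleRegime (rL rU : ℝ) (d : ℕ) (y : ℤ → ℝ) : ℕ → Bool
  | 0 => true
  | t + 1 => switch rL rU (y (((t + 1 : ℕ) : ℤ) - (d : ℤ))) (sampleRegime rL rU d y t)

/-- Contribution `log h_t + u_t² / h_t` of the observation at time `t`, evaluated with the
regime indicators computed from the sample. -/
noncomputable def sampleLoss {p : ℕ} (y : ℤ → ℝ) (t : ℕ) (θ : Param p) : ℝ :=
  let R := sampleRegime θ.rL θ.rU θ.delay y t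
  Real.log (condVar θ R y t) + (y t - condMean θ R y t) ^ 2 / condVar θ R y t

/-- The Gaussian quasi-likelihood criterion, the sum of the losses over `t = 1, …, n`. It depends
on `y` only through the observations from time `1 - max p dmax` to time `n` when the delay
is at most `dmax`. -/
noncomputable def criterion {p : ℕ} (y : ℤ → ℝ) (n : ℕ) (θ : Param p) : ℝ :=
  ∑ t ∈ Finset.Icc 1 n, sampleLoss y t θ

/-- `θ` is a Gaussian quasi-maximum likelihood estimate over `Θ` from the path `y` and the sample
size `n`: it minimizes the criterion over `Θ`. -/
def IsQMLE {p : ℕ} (Θ : Set (Param p)) (y : ℤ → ℝ) (n : ℕ) (θ : Param p) : Prop :=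
  θ ∈ Θ ∧ IsMinOn (criterion y n) Θ θ

end BDAR

/-!
The proof follows Wald's argument for minimum contrast estimators. Let `ℓ_t(θ)` be the loss at time
`t` with the regime determined by the infinite past of the observations (`bufferRegime`,
`bufferLoss`). Since a stationary ergodic path leaves `[a, b]` infinitely often in both directions
of time (`ae_exists_notMem`), the regimes of the model are functions of the past
(`IsModel.ae_eq_bufferRegime`), and the regimes computed from the sample agree with those of the
infinite past from some time on which does not depend on `θ`
(`sampleLoss_eq_bufferLoss_of_mem`). The criterion is therefore a Birkhoff sum of `ℓ_0(θ)` up to a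
bounded error.

*Contrast.* Given the past, the loss at `θ` has conditional mean `log v + (v₀ + (μ₀ - μ)²) / v`,
with `μ`, `v` the conditional mean and variance at `θ`, and `μ₀`, `v₀` those at `θ₀`. This is
smallest exactly when `μ = μ₀` and `v = v₀`. As each observation, given the past, has a positive
density, any two observations visit any two open sets, and nonzero linear forms in the past (or in
its squares) do not vanish; this forces `θ = θ₀` (`LocationScale.eq_of_ae_eq`,
`integral_bufferLoss_lt`).

*Local uniformity.* The loss is discontinuous in the boundaries `r_L`, `r_U`, but the regime is
monotone in them. So over a neighbourhood of `θ` the regime is squeezed between its values at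
`(r_L - δ, r_U - δ)` and `(r_L + δ, r_U + δ)`. If these agree, the loss drops by at most `δ` times an
integrable variable (`regimeLoss_sub_le`); if not, the loss is still at least `log m`, where `m` is
a lower bound of the variance coefficients. This gives a measurable `minorant` of the loss over the
neighbourhood, whose mean tends to that of `ℓ_0(θ)` as `δ → 0`, because observations almost surely
avoid `r_L` and `r_U` (`tendsto_integral_minorant`).

*Conclusion.* By the one-sided pointwise ergodic theorem (`ae_eventually_lt_birkhoffSum`), every
`θ ≠ θ₀` has a neighbourhood in which, eventually, no parameter does as well as `θ₀`
(`ae_eventually_criterion_lt`). Countably many of these neighbourhoods cover the complement of `θ₀`,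
and the parameter space is compact, so the estimates converge to `θ₀`.
-/

namespace BDAR

/-! ### One-sided pointwise ergodic theorem -/

section Birkhoff

variable {α : Type*}

/-- The running maximum `max_{k ≤ n} (g + g ∘ T + ⋯ + g ∘ T^[k-1])` of the Birkhoff sums,
written as the recursion that it satisfies along the orbit. -/
noncomputable def runMax (T : α → α) (g : α → ℝ) : ℕ → α → ℝ
  | 0 => fun _ => 0
  | n + 1 => fun x => max 0 (g x + runMax T g n (T x))

variable {T : α → α} {g : α → ℝ}

lemma runMax_nonneg (n : ℕ) (x : α) : 0 ≤ runMax T g n x := by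
  cases n with
  | zero => exact le_rfl
  | succ n => exact le_max_left _ _

lemma runMax_le_succ (n : ℕ) (x : α) : runMax T g n x ≤ runMax T g (n + 1) x := by
  induction n generalizing x with
  | zero => exact runMax_nonneg 1 x
  | succ n ih => exact max_le_max le_rfl (add_le_add le_rfl (ih (T x)))

lemma runMax_mono (x : α) : Monotone fun n => runMax T g n x :=
  monotone_nat_of_le_succ fun n => runMax_le_succ n x

lemma birkhoffSum_le_runMax (n : ℕ) (x : α) : birkhoffSum T g n x ≤ runMax T g n x := by
  induction n generalizing x with
  | zero => simp [runMax]
  | succ n ih =>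
    rw [birkhoffSum_succ']
    exact (add_le_add le_rfl (ih (T x))).trans (le_max_right _ _)

lemma bddAbove_runMax_comp_iff (x : α) :
    BddAbove (Set.range fun n => runMax T g n (T x)) ↔
      BddAbove (Set.range fun n => runMax T g n x) := by
  constructor
  · rintro ⟨B, hB⟩
    have hB' : ∀ n, runMax T g n (T x) ≤ B := fun n => hB ⟨n, rfl⟩
    refine ⟨max 0 (g x + B), ?_⟩
    rintro _ ⟨n, rfl⟩
    cases n with
    | zero => exact le_max_left _ _
    | succ n => exact max_le_max le_rfl (add_le_add le_rfl (hB' n))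
  · rintro ⟨B, hB⟩
    have hB' : ∀ n, runMax T g n x ≤ B := fun n => hB ⟨n, rfl⟩
    refine ⟨B - g x, ?_⟩
    rintro _ ⟨n, rfl⟩
    have := (le_max_right 0 (g x + runMax T g n (T x))).trans (hB' (n + 1))
    change runMax T g n (T x) ≤ B - g x
    linarith

variable [MeasurableSpace α] {μ : Measure α}

lemma measurable_runMax (hT : Measurable T) (hg : Measurable g) (n : ℕ) :
    Measurable (runMax T g n) := by
  induction n with
  | zero => exact measurable_const
  | succ n ih => exact measurable_const.max (hg.add (ih.comp hT))

lemma integrable_runMax [IsFiniteMeasure μ] (hT : MeasurePreserving T μ μ)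
    (hgi : Integrable g μ) (n : ℕ) : Integrable (runMax T g n) μ := by
  induction n with
  | zero => exact integrable_const 0
  | succ n ih => exact (integrable_const 0).sup (hgi.add (hT.integrable_comp_of_integrable ih))

/-- If `g` has negative mean under an ergodic transformation, the running maxima of its Birkhoff
sums are bounded along almost every orbit. The set where they are unbounded is invariant; were it
of full measure, the increments `runMax (n + 1) - runMax n ∘ T`, whose integrals are nonnegative,
would converge to `g`. -/
lemma ae_bddAbove_runMax [IsProbabilityMeasure μ] (hT : MeasurePreserving T μ μ)
    (hT' : PreErgodic T μ) (hg : Measurable g) (hgi : Integrable g μ) (hneg : ∫ x, g x ∂μ < 0) :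
    ∀ᵐ x ∂μ, BddAbove (Set.range fun n => runMax T g n x) := by
  have hmeas : MeasurableSet {x | BddAbove (Set.range fun n => runMax T g n x)} :=
    measurableSet_bddAbove_range fun n => measurable_runMax hT.measurable hg n
  rcases hT'.ae_mem_or_ae_notMem hmeas
    (Set.ext fun x => bddAbove_runMax_comp_iff x) with h | h
  · exact h
  exfalso
  have hFi := integrable_runMax hT hgi
  have hlim : Tendsto (fun n => ∫ x, (runMax T g (n + 1) x - runMax T g n (T x)) ∂μ) atTop
      (𝓝 (∫ x, g x ∂μ)) := by
    refine tendsto_integral_of_dominated_convergence (fun x => |g x|) (fun n => ?_) hgi.abs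
      (fun n => ?_) ?_
    · exact ((measurable_runMax hT.measurable hg _).sub
        ((measurable_runMax hT.measurable hg n).comp hT.measurable)).aestronglyMeasurable
    · refine Eventually.of_forall fun x => ?_
      have h0 := runMax_nonneg (T := T) (g := g) n (T x)
      change |max 0 (g x + runMax T g n (T x)) - runMax T g n (T x)| ≤ |g x|
      rcases le_total 0 (g x + runMax T g n (T x)) with h1 | h1
      · rw [max_eq_right h1]; simp
      · rw [max_eq_left h1, zero_sub, abs_neg, abs_of_nonneg h0, abs_of_nonpos (by linarith)]
        linarith
    · filter_upwards [h] with x hx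
      have hx' : ¬ BddAbove (Set.range fun n => runMax T g n (T x)) := fun hb =>
        hx ((bddAbove_runMax_comp_iff x).1 hb)
      have htop := tendsto_atTop_atTop_of_monotone' (runMax_mono (T := T) (g := g) (T x)) hx'
      refine tendsto_const_nhds.congr' ?_
      filter_upwards [htop.eventually_ge_atTop (-g x)] with n hn
      change g x = max 0 (g x + runMax T g n (T x)) - runMax T g n (T x)
      rw [max_eq_right (by linarith)]
      ring
  refine absurd (ge_of_tendsto' hlim fun n => ?_) (not_le.2 hneg)
  have hcomp : ∫ x, runMax T g n (T x) ∂μ = ∫ x, runMax T g n x ∂μ := by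
    have := integral_map (μ := μ) hT.measurable.aemeasurable (f := runMax T g n)
      (measurable_runMax hT.measurable hg n).aestronglyMeasurable
    rw [hT.map_eq] at this
    exact this.symm
  have hFi' : Integrable (fun x => runMax T g n (T x)) μ :=
    hT.integrable_comp_of_integrable (hFi n)
  rw [integral_sub (hFi _) hFi', hcomp, sub_nonneg]
  exact integral_mono (hFi n) (hFi (n + 1)) fun x => runMax_le_succ n x

/-- Upper half of the pointwise ergodic theorem. -/
lemma ae_eventually_birkhoffSum_lt [IsProbabilityMeasure μ] (hT : MeasurePreserving T μ μ)
    (hT' : PreErgodic T μ) (hg : Measurable g) (hgi : Integrable g μ) {c : ℝ}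
    (hc : ∫ x, g x ∂μ < c) :
    ∀ᵐ x ∂μ, ∀ C : ℝ, ∀ᶠ n : ℕ in atTop, birkhoffSum T g n x + C < n * c := by
  obtain ⟨c', h1, h2⟩ := exists_between hc
  have hneg : ∫ x, (g x - c') ∂μ < 0 := by
    rw [integral_sub hgi (integrable_const _)]
    simpa using h1
  filter_upwards [ae_bddAbove_runMax hT hT' (hg.sub_const c')
    (hgi.sub (integrable_const c')) hneg] with x ⟨B, hB⟩ C
  have hB' : ∀ n : ℕ, birkhoffSum T g n x ≤ n * c' + B := fun n => by
    have h3 := (birkhoffSum_le_runMax (T := T) (g := fun x => g x - c') n x).trans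
      (hB ⟨n, rfl⟩)
    simp only [birkhoffSum, Finset.sum_sub_distrib, Finset.sum_const, Finset.card_range,
      nsmul_eq_mul] at h3 ⊢
    linarith
  have hlim : Tendsto (fun n : ℕ => (n : ℝ) * (c - c')) atTop atTop :=
    tendsto_natCast_atTop_atTop.atTop_mul_const (sub_pos.2 h2)
  filter_upwards [hlim.eventually_gt_atTop (B + C)] with n hn
  have := hB' n
  linarith [mul_sub (n : ℝ) c c']

/-- Lower half of the pointwise ergodic theorem. -/
lemma ae_eventually_lt_birkhoffSum [IsProbabilityMeasure μ] (hT : MeasurePreserving T μ μ)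
    (hT' : PreErgodic T μ) (hg : Measurable g) (hgi : Integrable g μ) {c : ℝ}
    (hc : c < ∫ x, g x ∂μ) :
    ∀ᵐ x ∂μ, ∀ C : ℝ, ∀ᶠ n : ℕ in atTop, n * c + C < birkhoffSum T g n x := by
  filter_upwards [ae_eventually_birkhoffSum_lt hT hT' hg.neg hgi.neg (c := -c)
    (by simpa [integral_neg] using hc)] with x hx C
  filter_upwards [hx C] with n hn
  simp only [birkhoffSum, Pi.neg_apply, Finset.sum_neg_distrib] at hn ⊢
  linarith

end Birkhoff

/-! ### The regime determined by the infinite past -/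

open Classical in
/-- The regime at time `t` computed from the whole past of `x`: it is the lower regime when the
last threshold variable outside the buffer zone `(rL, rU]` was at most `rL`. On paths which never
left the buffer zone before time `t` the value is `false`. -/
noncomputable def bufferRegime (rL rU : ℝ) (d : ℕ) (x : ℤ → ℝ) (t : ℤ) : Bool :=
  decide (∃ k : ℕ, x (t - d - k) ≤ rL ∧ ∀ j : ℕ, j < k → x (t - d - j) ≤ rU)

variable {rL rU rL' rU' a b : ℝ} {d : ℕ} {x x' : ℤ → ℝ} {t : ℤ}

lemma bufferRegime_eq_true_iff : bufferRegime rL rU d x t = true ↔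
    ∃ k : ℕ, x (t - d - k) ≤ rL ∧ ∀ j : ℕ, j < k → x (t - d - j) ≤ rU := by
  simp [bufferRegime]

lemma bufferRegime_succ (rL rU : ℝ) (d : ℕ) (x : ℤ → ℝ) (t : ℤ) :
    bufferRegime rL rU d x t = switch rL rU (x (t - d)) (bufferRegime rL rU d x (t - 1)) := by
  unfold switch
  split_ifs with h1 h2
  · exact bufferRegime_eq_true_iff.2 ⟨0, by simpa using h1, by simp⟩
  · rw [Bool.eq_false_iff, Ne, bufferRegime_eq_true_iff]
    rintro ⟨k, hk, hj⟩
    rcases Nat.eq_zero_or_pos k with rfl | hk0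
    · exact h1 (by simpa using hk)
    · have := hj 0 hk0
      simp only [Nat.cast_zero, sub_zero] at this
      linarith
  · rw [Bool.eq_iff_iff, bufferRegime_eq_true_iff, bufferRegime_eq_true_iff]
    constructor
    · rintro ⟨k, hk, hj⟩
      cases k with
      | zero => exact absurd (by simpa using hk) h1
      | succ k =>
        refine ⟨k, ?_, fun j hjk => ?_⟩
        · convert hk using 2; push_cast; ring
        · convert hj (j + 1) (by omega) using 2; push_cast; ring
    · rintro ⟨k, hk, hj⟩
      refine ⟨k + 1, ?_, fun j hjk => ?_⟩
      · convert hk using 2; push_cast; ring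
      · cases j with
        | zero => simpa using not_lt.1 h2
        | succ j => convert hj j (by omega) using 2; push_cast; ring

lemma bufferRegime_mono (hL : rL ≤ rL') (hU : rU ≤ rU')
    (h : bufferRegime rL rU d x t = true) : bufferRegime rL' rU' d x t = true := by
  rw [bufferRegime_eq_true_iff] at h ⊢
  obtain ⟨k, hk, hj⟩ := h
  exact ⟨k, hk.trans hL, fun j hjk => (hj j hjk).trans hU⟩

lemma bufferRegime_congr (hd : 1 ≤ d) (h : ∀ s < t, x s = x' s) :
    bufferRegime rL rU d x t = bufferRegime rL rU d x' t := by
  have h' : ∀ k : ℕ, x (t - d - k) = x' (t - d - k) := fun k => h _ (by omega)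
  rw [Bool.eq_iff_iff, bufferRegime_eq_true_iff, bufferRegime_eq_true_iff]
  simp only [h']

lemma measurable_bufferRegime (rL rU : ℝ) (d : ℕ) (t : ℤ) :
    Measurable fun x => bufferRegime rL rU d x t := by
  refine measurable_to_bool ?_
  have : (fun x => bufferRegime rL rU d x t) ⁻¹' {true} =
      ⋃ k : ℕ, ({x | x (t - d - k) ≤ rL} ∩ ⋂ j : ℕ, ⋂ _ : j < k, {x | x (t - d - j) ≤ rU}) := by
    ext x
    simp [bufferRegime_eq_true_iff]
  rw [this]
  exact MeasurableSet.iUnion fun k =>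
    (measurableSet_le (measurable_pi_apply _) measurable_const).inter <|
      MeasurableSet.iInter fun j => MeasurableSet.iInter fun _ =>
        measurableSet_le (measurable_pi_apply _) measurable_const

/-- A threshold variable outside `[a, b]` determines the regime. -/
lemma switch_eq_switch (ha : a ≤ rL) (hb : rU ≤ b) {z : ℝ} (hz : z ∉ Set.Icc a b)
    (R R' : Bool) : switch rL rU z R = switch rL rU z R' := by
  unfold switch
  split_ifs with h1 h2
  · rfl
  · rfl
  · exact absurd ⟨(ha.trans_lt (not_le.1 h1)).le, (not_lt.1 h2).trans hb⟩ hz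

/-- A sequence of indicators following the regime recursion agrees with `bufferRegime` as soon as
one threshold variable was outside `[a, b]`. -/
lemma eq_bufferRegime_of_switch {R : ℤ → Bool} (ha : a ≤ rL) (hb : rU ≤ b)
    {s : ℤ} (hR : ∀ t ≥ s, R t = switch rL rU (x (t - d)) (R (t - 1)))
    (hs : x (s - d) ∉ Set.Icc a b) (hst : s ≤ t) : R t = bufferRegime rL rU d x t := by
  induction t, hst using Int.leInduction with
  | base =>
    rw [hR s le_rfl, bufferRegime_succ]
    exact switch_eq_switch ha hb hs _ _
  | succ n hn ih =>
    rw [hR (n + 1) (by omega), bufferRegime_succ, add_sub_cancel_right, ih]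

lemma sampleRegime_eq_bufferRegime (ha : a ≤ rL) (hb : rU ≤ b)
    {s : ℕ} (hs0 : 1 ≤ s) (hs : x ((s : ℤ) - d) ∉ Set.Icc a b) {n : ℕ} (hn : s ≤ n) :
    sampleRegime rL rU d x n = bufferRegime rL rU d x n := by
  have := eq_bufferRegime_of_switch (x := x) (d := d) (s := s) (t := n)
    (R := fun t => sampleRegime rL rU d x t.toNat) ha hb (fun t ht => ?_) hs
    (by exact_mod_cast hn)
  · simpa using this
  · obtain ⟨k, rfl⟩ : ∃ k : ℕ, t = ((k + 1 : ℕ) : ℤ) := ⟨(t - 1).toNat, by omega⟩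
    have h1 : (((k + 1 : ℕ) : ℤ) - 1).toNat = k := by omega
    simp only [Int.toNat_natCast, h1]
    rfl

/-- The regime is locally constant in the boundaries, as long as no threshold variable hits a
boundary exactly and one of them was outside `[a, b]`. -/
lemma eventually_bufferRegime_eq (ha : a ≤ rL) (hb : rU ≤ b)
    (hne : ∀ s, x s ≠ rL ∧ x s ≠ rU) {s : ℤ} (hs : x (s - d) ∉ Set.Icc a b) (hst : s ≤ t) :
    ∀ᶠ e : ℝ in 𝓝 0,
      bufferRegime (rL + e) (rU + e) d x t = bufferRegime rL rU d x t := by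
  have hsw : ∀ r : ℤ, ∀ᶠ e : ℝ in 𝓝 0, ∀ R : Bool,
      switch (rL + e) (rU + e) (x r) R = switch rL rU (x r) R := by
    intro r
    have hc : ∀ c : ℝ, x r ≠ c → ∀ᶠ e : ℝ in 𝓝 0, (x r ≤ c + e ↔ x r ≤ c) := by
      intro c hc
      have ht : Tendsto (fun e : ℝ => c + e) (𝓝 0) (𝓝 c) := by
        simpa using (by fun_prop : Continuous fun e : ℝ => c + e).tendsto 0
      rcases lt_or_gt_of_ne hc with h | h
      · filter_upwards [ht.eventually_const_lt h] with e he
        simp [he.le, h.le]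
      · filter_upwards [ht.eventually_lt_const h] with e he
        simp [not_le.2 he, not_le.2 h]
    filter_upwards [hc rL (hne r).1, hc rU (hne r).2] with e h1 h2 R
    simp only [switch, ← not_le, h1, h2]
  induction t, hst using Int.leInduction with
  | base =>
    filter_upwards [hsw (s - d)] with e he
    rw [bufferRegime_succ _ _ _ _ s, he, bufferRegime_succ rL rU]
    exact switch_eq_switch ha hb hs _ _
  | succ n hn ih =>
    filter_upwards [hsw (n + 1 - d), ih] with e he h2
    rw [bufferRegime_succ _ _ _ _ (n + 1), he, bufferRegime_succ rL rU, add_sub_cancel_right, h2]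

lemma shift_iterate_apply (n : ℕ) (x : ℤ → ℝ) (t : ℤ) : shift^[n] x t = x (t + n) := by
  induction n generalizing x t with
  | zero => simp
  | succ n ih =>
    rw [Function.iterate_succ_apply, ih]
    simp only [shift]
    congr 1
    push_cast
    ring

lemma bufferRegime_shift_iterate (n : ℕ) :
    bufferRegime rL rU d (shift^[n] x) 0 = bufferRegime rL rU d x n := by
  have h : ∀ k : ℕ, (0 : ℤ) - d - k + n = n - d - k := fun k => by ring
  rw [Bool.eq_iff_iff, bufferRegime_eq_true_iff, bufferRegime_eq_true_iff]
  simp only [shift_iterate_apply, h]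

/-! ### The loss of one regime and its modulus of continuity -/

section Loss

variable {p : ℕ}

/-- The sum `1 + ∑ |x_{t-j}|`, which controls differences of conditional means. -/
def absSum (p : ℕ) (x : ℤ → ℝ) (t : ℤ) : ℝ := 1 + ∑ i : Fin p, |x (t - ((i : ℤ) + 1))|

/-- The sum `1 + ∑ x_{t-j}²`, which is comparable to every conditional variance. -/
def sqSum (p : ℕ) (x : ℤ → ℝ) (t : ℤ) : ℝ := 1 + ∑ i : Fin p, x (t - ((i : ℤ) + 1)) ^ 2

lemma one_le_absSum (x : ℤ → ℝ) (t : ℤ) : 1 ≤ absSum p x t := by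
  have : 0 ≤ ∑ i : Fin p, |x (t - ((i : ℤ) + 1))| := Finset.sum_nonneg fun _ _ => abs_nonneg _
  unfold absSum
  linarith

lemma one_le_sqSum (x : ℤ → ℝ) (t : ℤ) : 1 ≤ sqSum p x t := by
  have : 0 ≤ ∑ i : Fin p, x (t - ((i : ℤ) + 1)) ^ 2 := Finset.sum_nonneg fun _ _ => sq_nonneg _
  unfold sqSum
  linarith

lemma linMean_sub (φ φ' : Fin (p + 1) → ℝ) (x : ℤ → ℝ) (t : ℤ) :
    linMean φ x t - linMean φ' x t = linMean (φ - φ') x t := by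
  simp only [linMean, Pi.sub_apply, sub_mul, Finset.sum_sub_distrib]
  ring

lemma quadVar_sub (α α' : Fin (p + 1) → ℝ) (x : ℤ → ℝ) (t : ℤ) :
    quadVar α x t - quadVar α' x t = quadVar (α - α') x t := by
  simp only [quadVar, Pi.sub_apply, sub_mul, Finset.sum_sub_distrib]
  ring

lemma abs_linMean_le {φ : Fin (p + 1) → ℝ} {δ : ℝ} (h : ∀ i, |φ i| ≤ δ) (x : ℤ → ℝ) (t : ℤ) :
    |linMean φ x t| ≤ δ * absSum p x t := by
  unfold linMean absSum
  refine (abs_add_le _ _).trans ?_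
  rw [mul_add, mul_one, Finset.mul_sum]
  refine add_le_add (h 0) ((Finset.abs_sum_le_sum_abs _ _).trans
    (Finset.sum_le_sum fun i _ => ?_))
  rw [abs_mul]
  exact mul_le_mul_of_nonneg_right (h _) (abs_nonneg _)

lemma abs_quadVar_le {α : Fin (p + 1) → ℝ} {δ : ℝ} (h : ∀ i, |α i| ≤ δ) (x : ℤ → ℝ) (t : ℤ) :
    |quadVar α x t| ≤ δ * sqSum p x t := by
  unfold quadVar sqSum
  refine (abs_add_le _ _).trans ?_
  rw [mul_add, mul_one, Finset.mul_sum]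
  refine add_le_add (h 0) ((Finset.abs_sum_le_sum_abs _ _).trans
    (Finset.sum_le_sum fun i _ => ?_))
  rw [abs_mul, abs_sq]
  exact mul_le_mul_of_nonneg_right (h _) (sq_nonneg _)

lemma mul_sqSum_le_quadVar {α : Fin (p + 1) → ℝ} {m : ℝ} (h : ∀ i, m ≤ α i) (x : ℤ → ℝ)
    (t : ℤ) : m * sqSum p x t ≤ quadVar α x t := by
  unfold quadVar sqSum
  rw [mul_add, mul_one, Finset.mul_sum]
  exact add_le_add (h 0) (Finset.sum_le_sum fun i _ =>
    mul_le_mul_of_nonneg_right (h _) (sq_nonneg _))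

lemma le_quadVar {α : Fin (p + 1) → ℝ} {m : ℝ} (hm : 0 ≤ m) (h : ∀ i, m ≤ α i) (x : ℤ → ℝ)
    (t : ℤ) : m ≤ quadVar α x t :=
  (le_mul_of_one_le_right hm (one_le_sqSum x t)).trans (mul_sqSum_le_quadVar h x t)

/-- The loss `log h + u² / h` at time `t` when one regime is in force. -/
noncomputable def regimeLoss (c : RegimeCoef p) (x : ℤ → ℝ) (t : ℤ) : ℝ :=
  Real.log (quadVar c.2 x t) + (x t - linMean c.1 x t) ^ 2 / quadVar c.2 x t

/-- A Lipschitz constant from below, at the coefficients `c`, for the loss of one regime, over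
coefficients whose variance part is at least `m`. -/
noncomputable def lossModulus (m : ℝ) (c : RegimeCoef p) (x : ℤ → ℝ) (t : ℤ) : ℝ :=
  1 / m + 2 * |x t - linMean c.1 x t| * absSum p x t / m + (x t - linMean c.1 x t) ^ 2 / m ^ 2

lemma lossModulus_nonneg {m : ℝ} (hm : 0 < m) (c : RegimeCoef p) (x : ℤ → ℝ) (t : ℤ) :
    0 ≤ lossModulus m c x t := by
  have := one_le_absSum (p := p) x t
  unfold lossModulus
  positivity

lemma log_le_regimeLoss {m : ℝ} (hm : 0 < m) {c : RegimeCoef p} (h : ∀ i, m ≤ c.2 i)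
    (x : ℤ → ℝ) (t : ℤ) : Real.log m ≤ regimeLoss c x t := by
  have h1 := le_quadVar hm.le h x t
  have h2 : 0 ≤ (x t - linMean c.1 x t) ^ 2 / quadVar c.2 x t :=
    div_nonneg (sq_nonneg _) (hm.le.trans h1)
  have h3 := Real.log_le_log hm h1
  unfold regimeLoss
  linarith

/-- The loss of one regime drops by at most `δ * lossModulus` when the coefficients move by at most
`δ`. With `S = sqSum` and variances at least `m * S`, the logarithm contributes `1 / m`, the change
of the mean `2 |u| A / m`, and the change of the denominator `u² / m²`. -/
lemma regimeLoss_sub_le {m δ : ℝ} (hm : 0 < m) {c c' : RegimeCoef p} (h : ∀ i, m ≤ c.2 i)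
    (h' : ∀ i, m ≤ c'.2 i) (h1 : ∀ i, |c'.1 i - c.1 i| ≤ δ) (h2 : ∀ i, |c'.2 i - c.2 i| ≤ δ)
    (x : ℤ → ℝ) (t : ℤ) :
    regimeLoss c x t - δ * lossModulus m c x t ≤ regimeLoss c' x t := by
  have hδ : 0 ≤ δ := (abs_nonneg _).trans (h1 0)
  have hS := one_le_sqSum (p := p) x t
  have hA := one_le_absSum (p := p) x t
  have hv := mul_sqSum_le_quadVar h x t
  have hv' := mul_sqSum_le_quadVar h' x t
  have hm' := le_quadVar hm.le h' x t
  have hd : |quadVar c'.2 x t - quadVar c.2 x t| ≤ δ * sqSum p x t := by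
    rw [quadVar_sub]; exact abs_quadVar_le h2 x t
  have he : |linMean c'.1 x t - linMean c.1 x t| ≤ δ * absSum p x t := by
    rw [linMean_sub]; exact abs_linMean_le h1 x t
  unfold regimeLoss lossModulus
  set S := sqSum p x t
  set A := absSum p x t
  set v := quadVar c.2 x t
  set v' := quadVar c'.2 x t
  set u := x t - linMean c.1 x t with hu
  have hu' : x t - linMean c'.1 x t = u - (linMean c'.1 x t - linMean c.1 x t) := by
    rw [hu]; ring
  rw [hu']
  set e := linMean c'.1 x t - linMean c.1 x t
  have hmS : 0 < m * S := by positivity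
  have hv0 : 0 < v := hmS.trans_le hv
  have hv0' : 0 < v' := hmS.trans_le hv'
  rw [abs_le] at hd
  have hlog : Real.log v - Real.log v' ≤ δ * (1 / m) := by
    rw [← Real.log_div hv0.ne' hv0'.ne']
    refine (Real.log_le_sub_one_of_pos (by positivity)).trans ?_
    rw [div_sub_one hv0'.ne', mul_one_div, div_le_div_iff₀ hv0' hm]
    nlinarith
  have hquad : u ^ 2 / v - u ^ 2 / v' ≤ δ * (u ^ 2 / m ^ 2) := by
    have e1 : u ^ 2 / v - u ^ 2 / v' = u ^ 2 * ((v' - v) / (v * v')) := by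
      field_simp
    have e2 : (v' - v) / (v * v') ≤ δ / m ^ 2 := by
      rw [div_le_div_iff₀ (by positivity) (by positivity)]
      have e3 : (m * S) * (m * S) ≤ v * v' := mul_le_mul hv hv' hmS.le hv0.le
      calc (v' - v) * m ^ 2 ≤ δ * S * m ^ 2 := by
            exact mul_le_mul_of_nonneg_right hd.2 (sq_nonneg _)
        _ ≤ δ * ((m * S) * (m * S)) := by
            have : S ≤ S * S := le_mul_of_one_le_left (by linarith) hS
            nlinarith [mul_nonneg hδ (sq_nonneg m)]
        _ ≤ δ * (v * v') := mul_le_mul_of_nonneg_left e3 hδ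
    rw [e1]
    refine (mul_le_mul_of_nonneg_left e2 (sq_nonneg u)).trans_eq ?_
    ring
  have hcross : u ^ 2 / v' - (u - e) ^ 2 / v' ≤ δ * (2 * |u| * A / m) := by
    have e1 : u ^ 2 - (u - e) ^ 2 ≤ 2 * |u| * (δ * A) := by
      have e2 : u * e ≤ |u| * (δ * A) :=
        (le_abs_self _).trans ((abs_mul u e).trans_le
          (mul_le_mul_of_nonneg_left he (abs_nonneg u)))
      nlinarith [sq_nonneg e]
    have e3 : 0 ≤ 2 * |u| * (δ * A) := by positivity
    rw [← sub_div]
    calc (u ^ 2 - (u - e) ^ 2) / v' ≤ 2 * |u| * (δ * A) / v' :=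
          div_le_div_of_nonneg_right e1 hv0'.le
      _ ≤ 2 * |u| * (δ * A) / m := div_le_div_of_nonneg_left e3 hm hm'
      _ = δ * (2 * |u| * A / m) := by ring
  linarith

/-- The loss at time `t` evaluated with the regime determined by the infinite past. -/
noncomputable def bufferLoss (θ : Param p) (x : ℤ → ℝ) (t : ℤ) : ℝ :=
  regimeLoss (θ.regime (bufferRegime θ.rL θ.rU θ.delay x t)) x t

lemma regimeLoss_shift_iterate (c : RegimeCoef p) (n : ℕ) :
    regimeLoss c (shift^[n] x) 0 = regimeLoss c x n := by
  have h : ∀ k : ℤ, (0 : ℤ) - k + n = n - k := fun k => by ring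
  simp only [regimeLoss, linMean, quadVar, shift_iterate_apply, h, zero_add]

lemma bufferLoss_shift_iterate (θ : Param p) (n : ℕ) :
    bufferLoss θ (shift^[n] x) 0 = bufferLoss θ x n := by
  simp only [bufferLoss, bufferRegime_shift_iterate, regimeLoss_shift_iterate]

/-- The coefficients of both regimes have all variance entries at least `m`. -/
def VarBound (m : ℝ) (θ : Param p) : Prop := ∀ R i, m ≤ (θ.regime R).2 i

lemma log_le_bufferLoss {m : ℝ} (hm : 0 < m) {θ : Param p} (h : VarBound m θ) (x : ℤ → ℝ)
    (t : ℤ) : Real.log m ≤ bufferLoss θ x t :=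
  log_le_regimeLoss hm (h _) x t

/-- A lower bound for the loss at time `0` over all parameters within distance `δ` of `θ`. Since
the regime is monotone in the boundaries, it is constant over these parameters when it takes the
same value at the two extreme boundaries; otherwise only the bound `log m` is used. -/
noncomputable def minorant (m : ℝ) (θ : Param p) (δ : ℝ) (x : ℤ → ℝ) : ℝ :=
  bufferLoss θ x 0 - δ * (lossModulus m (θ.regime true) x 0 + lossModulus m (θ.regime false) x 0)
    - if bufferRegime (θ.rL + -δ) (θ.rU + -δ) θ.delay x 0
        = bufferRegime (θ.rL + δ) (θ.rU + δ) θ.delay x 0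
      then 0 else |bufferLoss θ x 0| + |Real.log m|

/-- `θ'` has the delay of `θ`, and all its other entries are within `δ` of those of `θ`. -/
def Near (δ : ℝ) (θ θ' : Param p) : Prop :=
  θ'.delay = θ.delay ∧ |θ'.rL - θ.rL| ≤ δ ∧ |θ'.rU - θ.rU| ≤ δ ∧
    ∀ R i, |(θ'.regime R).1 i - (θ.regime R).1 i| ≤ δ ∧ |(θ'.regime R).2 i - (θ.regime R).2 i| ≤ δ

/-- Nearness holds on a neighbourhood of `θ`, the topology of the delay being discrete. -/
lemma eventually_near (θ : Param p) {δ : ℝ} (hδ : 0 < δ) : ∀ᶠ θ' in 𝓝 θ, Near δ θ θ' := by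
  have hc : ∀ f : Param p → ℝ, Continuous f → ∀ᶠ θ' in 𝓝 θ, |f θ' - f θ| ≤ δ := fun f hf => by
    filter_upwards [hf.continuousAt.eventually (Metric.ball_mem_nhds (f θ) hδ)] with θ' h
    exact (Real.dist_eq _ _ ▸ h).le
  have hd : ∀ᶠ θ' : Param p in 𝓝 θ, θ'.delay = θ.delay := by
    have : Continuous fun θ : Param p => θ.delay := by unfold Param.delay; fun_prop
    exact this.continuousAt.eventually (isOpen_discrete {θ.delay} |>.mem_nhds rfl)
  refine hd.and ((hc _ (by unfold Param.rL; fun_prop)).and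
    ((hc _ (by unfold Param.rU; fun_prop)).and ?_))
  have hr : ∀ R, Continuous fun θ : Param p => θ.regime R := fun R => by
    cases R
    · exact continuous_fst.snd
    · exact continuous_fst.fst
  refine eventually_all.2 fun R => eventually_all.2 fun i => ?_
  have hR := hr R
  exact (hc (fun θ => (θ.regime R).1 i) (by fun_prop)).and
    (hc (fun θ => (θ.regime R).2 i) (by fun_prop))

lemma minorant_le {m δ : ℝ} (hm : 0 < m) {θ θ' : Param p} (h : VarBound m θ)
    (h' : VarBound m θ') (hn : Near δ θ θ') (x : ℤ → ℝ) :
    minorant m θ δ x ≤ bufferLoss θ' x 0 := by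
  obtain ⟨hd, hL, hU, hc⟩ := hn
  have hδ : 0 ≤ δ := (abs_nonneg _).trans hL
  have hK := fun R => lossModulus_nonneg hm (θ.regime R) x 0
  rw [abs_le] at hL hU
  unfold minorant
  split_ifs with hR
  · have hmono1 := bufferRegime_mono (x := x) (t := 0) (d := θ.delay)
      (show θ.rL + -δ ≤ θ.rL by linarith) (show θ.rU + -δ ≤ θ.rU by linarith)
    have hmono2 := bufferRegime_mono (x := x) (t := 0) (d := θ.delay)
      (show θ.rL ≤ θ.rL + δ by linarith) (show θ.rU ≤ θ.rU + δ by linarith)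
    have hmono3 := bufferRegime_mono (x := x) (t := 0) (d := θ.delay)
      (show θ.rL + -δ ≤ θ'.rL by linarith) (show θ.rU + -δ ≤ θ'.rU by linarith)
    have hmono4 := bufferRegime_mono (x := x) (t := 0) (d := θ.delay)
      (show θ'.rL ≤ θ.rL + δ by linarith) (show θ'.rU ≤ θ.rU + δ by linarith)
    have hRR : bufferRegime θ'.rL θ'.rU θ.delay x 0 = bufferRegime θ.rL θ.rU θ.delay x 0 := by
      rw [Bool.eq_iff_iff]
      constructor
      · exact fun h => hmono1 (hR.trans (hmono4 h))
      · exact fun h => hmono3 (hR.trans (hmono2 h))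
    have key := regimeLoss_sub_le hm (h (bufferRegime θ.rL θ.rU θ.delay x 0))
      (h' (bufferRegime θ.rL θ.rU θ.delay x 0)) (fun i => (hc _ i).1) (fun i => (hc _ i).2) x 0
    have hle : lossModulus m (θ.regime (bufferRegime θ.rL θ.rU θ.delay x 0)) x 0 ≤
        lossModulus m (θ.regime true) x 0 + lossModulus m (θ.regime false) x 0 := by
      cases bufferRegime θ.rL θ.rU θ.delay x 0
      · linarith [hK true]
      · linarith [hK false]
    have := mul_le_mul_of_nonneg_left hle hδ
    unfold bufferLoss
    rw [hd, hRR]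
    linarith
  · have h1 := log_le_bufferLoss hm h' x 0
    have h2 := mul_nonneg hδ (add_nonneg (hK true) (hK false))
    linarith [le_abs_self (bufferLoss θ x 0), neg_abs_le (Real.log m)]

lemma sampleLoss_eq_bufferLoss {θ : Param p} (ha : a ≤ θ.rL)
    (hb : θ.rU ≤ b) {s : ℕ} (hs0 : 1 ≤ s) (hs : x ((s : ℤ) - θ.delay) ∉ Set.Icc a b) {n : ℕ}
    (hn : s ≤ n) : sampleLoss x n θ = bufferLoss θ x n := by
  unfold bufferLoss
  rw [← sampleRegime_eq_bufferRegime ha hb hs0 hs hn]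
  rfl

lemma log_le_sampleLoss {m : ℝ} (hm : 0 < m) {θ : Param p} (h : VarBound m θ) (x : ℤ → ℝ)
    (n : ℕ) : Real.log m ≤ sampleLoss x n θ :=
  log_le_regimeLoss hm (h _) x n

end Loss

/-! ### Recurrence to the outside of the buffer zone -/

section Recurrence

variable {ν : Measure (ℤ → ℝ)}

lemma measure_coord_mem (hν : MeasurePreserving shift ν ν) {K : Set ℝ} (hK : MeasurableSet K)
    (s : ℤ) : ν {x | x s ∈ K} = ν {x | x 0 ∈ K} := by
  have hstep : ∀ s : ℤ, ν {x | x (s + 1) ∈ K} = ν {x | x s ∈ K} := fun s =>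
    hν.measure_preimage (s := {x | x s ∈ K}) (measurable_pi_apply s hK).nullMeasurableSet
  induction s using Int.induction_on with
  | zero => rfl
  | succ n ih => rw [hstep, ih]
  | pred n ih => rw [← ih, ← hstep, sub_add_cancel]

/-- A stationary ergodic path leaves `K` infinitely often along any sequence of times whose tails
are unchanged by the shift, if it is not in `K` almost surely. -/
lemma ae_exists_notMem [IsProbabilityMeasure ν] (hν : MeasurePreserving shift ν ν)
    (hν' : PreErgodic shift ν) {K : Set ℝ} (hK : MeasurableSet K) (hlt : ν {x | x 0 ∈ K} < 1)
    {u : ℕ → ℤ} (hu : (∀ n, u n + 1 = u (n + 1)) ∨ ∀ n, u (n + 1) + 1 = u n) :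
    ∀ᵐ x ∂ν, ∀ N : ℕ, ∃ n ≥ N, x (u n) ∉ K := by
  have hcoord : ∀ s : ℤ, MeasurableSet {x : ℤ → ℝ | x s ∈ K} := fun s => measurable_pi_apply s hK
  have hA : {x : ℤ → ℝ | ∀ N : ℕ, ∃ n ≥ N, x (u n) ∉ K} =
      (⋃ N : ℕ, ⋂ n : ℕ, ⋂ _ : n ≥ N, {x | x (u n) ∈ K})ᶜ := by
    ext x
    simp
  have hmeas : MeasurableSet {x : ℤ → ℝ | ∀ N : ℕ, ∃ n ≥ N, x (u n) ∉ K} := by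
    rw [hA]
    exact (MeasurableSet.iUnion fun N => MeasurableSet.iInter fun n => MeasurableSet.iInter
      fun _ => hcoord _).compl
  have hinv : shift ⁻¹' {x : ℤ → ℝ | ∀ N : ℕ, ∃ n ≥ N, x (u n) ∉ K} =
      {x : ℤ → ℝ | ∀ N : ℕ, ∃ n ≥ N, x (u n) ∉ K} := by
    ext x
    simp only [Set.mem_preimage, Set.mem_ofPred_eq, shift]
    rcases hu with hu | hu
    · simp only [hu]
      constructor
      · intro h N
        obtain ⟨n, hn, hx⟩ := h N
        exact ⟨n + 1, by omega, hx⟩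
      · intro h N
        obtain ⟨n, hn, hx⟩ := h (N + 1)
        obtain ⟨k, rfl⟩ : ∃ k, n = k + 1 := ⟨n - 1, by omega⟩
        exact ⟨k, by omega, hx⟩
    · constructor
      · intro h N
        obtain ⟨n, hn, hx⟩ := h (N + 1)
        obtain ⟨k, rfl⟩ : ∃ k, n = k + 1 := ⟨n - 1, by omega⟩
        exact ⟨k, by omega, by rwa [hu] at hx⟩
      · intro h N
        obtain ⟨n, hn, hx⟩ := h N
        exact ⟨n + 1, by omega, by rwa [hu]⟩
  rcases hν'.ae_mem_or_ae_notMem hmeas hinv with h | h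
  · exact h
  exfalso
  have h1 : ν (⋃ N : ℕ, ⋂ n : ℕ, ⋂ _ : n ≥ N, {x : ℤ → ℝ | x (u n) ∈ K}) = 1 := by
    rw [← prob_compl_eq_zero_iff, ← hA]
    · exact measure_eq_zero_iff_ae_notMem.2 h
    · exact (MeasurableSet.iUnion fun N => MeasurableSet.iInter fun n => MeasurableSet.iInter
        fun _ => hcoord _)
  rw [Monotone.measure_iUnion] at h1
  · refine hlt.not_ge (h1.symm.le.trans (iSup_le fun N => ?_))
    rw [← measure_coord_mem hν hK (u N)]
    exact measure_mono (Set.iInter₂_subset N le_rfl)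
  · intro N N' hN
    exact Set.iInter_mono fun n => Set.iInter_mono' fun hn => ⟨le_trans hN hn, le_rfl⟩

end Recurrence

/-! ### Observations as affine functions of an independent innovation -/

/-- The path `x` with its values at times `≥ t` replaced by zero. -/
def pastPart (t : ℤ) (x : ℤ → ℝ) : ℤ → ℝ := fun s => if s < t then x s else 0

lemma pastPart_of_lt {s t : ℤ} (h : s < t) (x : ℤ → ℝ) : pastPart t x s = x s := if_pos h

lemma measurable_pastPart (t : ℤ) : Measurable (pastPart t) := by
  refine measurable_pi_lambda _ fun s => ?_
  unfold pastPart
  split_ifs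
  · exact measurable_pi_apply s
  · exact measurable_const

/-- Each observation is an affine function, with coefficients determined by the past and positive
slope, of an innovation which is independent of the past and whose law is equivalent to Lebesgue
measure. -/
structure LocationScale {Ω : Type*} [MeasurableSpace Ω] (P : Measure Ω) (y ε : ℤ → Ω → ℝ) :
    Prop where
  measurable_y : ∀ t, Measurable (y t)
  measurable_innov : ∀ t, Measurable (ε t)
  indep : ∀ t, IndepFun (fun ω => pastPart t fun s => y s ω) (ε t) P
  law_ac : ∀ t, P.map (ε t) ≪ volume
  ac_law : ∀ t, volume ≪ P.map (ε t)
  affine : ∀ t, ∃ M V : (ℤ → ℝ) → ℝ, Measurable M ∧ Measurable V ∧ (∀ z, 0 < V z) ∧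
    ∀ᵐ ω ∂P, y t ω = M (pastPart t fun s => y s ω) + ε t ω * V (pastPart t fun s => y s ω)

namespace LocationScale

variable {Ω : Type*} [MeasurableSpace Ω] {P : Measure Ω} {y ε : ℤ → Ω → ℝ}

lemma measurable_path (h : LocationScale P y ε) : Measurable fun ω (s : ℤ) => y s ω :=
  measurable_pi_lambda _ h.measurable_y

lemma measurable_past (h : LocationScale P y ε) (t : ℤ) :
    Measurable fun ω => pastPart t fun s => y s ω :=
  (measurable_pastPart t).comp h.measurable_path

variable [IsProbabilityMeasure P]

lemma map_prod (h : LocationScale P y ε) (t : ℤ) :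
    P.map (fun ω => (pastPart t (fun s => y s ω), ε t ω)) =
      (P.map fun ω => pastPart t fun s => y s ω).prod (P.map (ε t)) :=
  (indepFun_iff_map_prod_eq_prod_map_map (h.measurable_past t).aemeasurable
    (h.measurable_innov t).aemeasurable).1 (h.indep t)

/-- An observation almost surely differs from any given function of the past. -/
lemma ae_ne (h : LocationScale P y ε) (t : ℤ) {W : (ℤ → ℝ) → ℝ} (hW : Measurable W) :
    ∀ᵐ ω ∂P, y t ω ≠ W (pastPart t fun s => y s ω) := by
  obtain ⟨M, V, hM, hV, hpos, heq⟩ := h.affine t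
  have hprob : IsProbabilityMeasure (P.map (ε t)) :=
    Measure.isProbabilityMeasure_map (h.measurable_innov t).aemeasurable
  have hS : MeasurableSet {q : (ℤ → ℝ) × ℝ | M q.1 + q.2 * V q.1 = W q.1} :=
    measurableSet_eq_fun (by fun_prop) (by fun_prop)
  have hnull : P.map (fun ω => (pastPart t (fun s => y s ω), ε t ω))
      {q : (ℤ → ℝ) × ℝ | M q.1 + q.2 * V q.1 = W q.1} = 0 := by
    rw [h.map_prod t, Measure.measure_prod_null hS]
    refine Eventually.of_forall fun z => ?_
    refine h.law_ac t (measure_mono_null (t := {(W z - M z) / V z}) (fun e he => ?_) (by simp))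
    rw [Set.mem_singleton_iff, eq_div_iff (hpos z).ne']
    have he' : M z + e * V z = W z := he
    linarith
  rw [Measure.map_apply ((h.measurable_past t).prodMk (h.measurable_innov t)) hS] at hnull
  filter_upwards [heq, measure_eq_zero_iff_ae_notMem.1 hnull] with ω h1 h2 h3
  exact h2 (show M _ + _ * V _ = W _ by rw [← h1, h3])

/-- Given any non-null event of the past, an observation falls in a nonempty open set with
positive probability. -/
lemma frequently_mem_and (h : LocationScale P y ε) (t : ℤ) {I : Set ℝ} (hI : IsOpen I)
    (hIne : I.Nonempty) {E : Set (ℤ → ℝ)} (hE : MeasurableSet E)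
    (hEf : ∃ᶠ ω in ae P, pastPart t (fun s => y s ω) ∈ E) :
    ∃ᶠ ω in ae P, y t ω ∈ I ∧ pastPart t (fun s => y s ω) ∈ E := by
  obtain ⟨M, V, hM, hV, hpos, heq⟩ := h.affine t
  have hprob : IsProbabilityMeasure (P.map (ε t)) :=
    Measure.isProbabilityMeasure_map (h.measurable_innov t).aemeasurable
  intro hcon
  have hS : MeasurableSet {q : (ℤ → ℝ) × ℝ | M q.1 + q.2 * V q.1 ∈ I ∧ q.1 ∈ E} := by
    refine MeasurableSet.inter ?_ (measurable_fst hE)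
    have hm : Measurable fun q : (ℤ → ℝ) × ℝ => M q.1 + q.2 * V q.1 := by fun_prop
    exact hm hI.measurableSet
  have hnull : P.map (fun ω => (pastPart t (fun s => y s ω), ε t ω))
      {q : (ℤ → ℝ) × ℝ | M q.1 + q.2 * V q.1 ∈ I ∧ q.1 ∈ E} = 0 := by
    rw [Measure.map_apply ((h.measurable_past t).prodMk (h.measurable_innov t)) hS]
    refine measure_eq_zero_iff_ae_notMem.2 ?_
    filter_upwards [heq, hcon] with ω h1 h2 h3
    exact h2 ⟨by rw [h1]; exact h3.1, h3.2⟩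
  rw [h.map_prod t, Measure.measure_prod_null hS] at hnull
  have hz := ae_of_ae_map (h.measurable_past t).aemeasurable hnull
  refine hEf ?_
  filter_upwards [hz] with ω hω hωE
  set z := pastPart t fun s => y s ω
  have hvol := h.ac_law t hω
  have hopen : IsOpen {e : ℝ | M z + e * V z ∈ I} :=
    hI.preimage (by fun_prop : Continuous fun e : ℝ => M z + e * V z)
  obtain ⟨i, hi⟩ := hIne
  refine (hopen.measure_pos volume ⟨(i - M z) / V z, ?_⟩).ne' ?_
  · have : M z + (i - M z) / V z * V z = i := by
      rw [div_mul_cancel₀ _ (hpos z).ne']; ring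
    simpa [this] using hi
  · convert hvol using 2
    ext e
    simp [hωE]

lemma frequently_mem (h : LocationScale P y ε) (t : ℤ) {I : Set ℝ} (hI : IsOpen I)
    (hIne : I.Nonempty) : ∃ᶠ ω in ae P, y t ω ∈ I := by
  have := h.frequently_mem_and t hI hIne MeasurableSet.univ
    (by simpa using (inferInstance : (ae P).NeBot).ne)
  exact this.mono fun ω hω => hω.1

lemma frequently_mem_mem (h : LocationScale P y ε) {s t : ℤ} (hst : s ≠ t) {I J : Set ℝ}
    (hI : IsOpen I) (hIne : I.Nonempty) (hJ : IsOpen J) (hJne : J.Nonempty) :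
    ∃ᶠ ω in ae P, y s ω ∈ I ∧ y t ω ∈ J := by
  wlog hlt : s < t generalizing s t I J
  · exact (this hst.symm hJ hJne hI hIne (lt_of_le_of_ne (not_lt.1 hlt) hst.symm)).mono
      fun ω hω => hω.symm
  have := h.frequently_mem_and t hJ hJne (E := {z | z s ∈ I})
    (measurable_pi_apply s hI.measurableSet)
    ((h.frequently_mem s hI hIne).mono fun ω hω => by
      simpa [pastPart_of_lt hlt] using hω)
  exact this.mono fun ω hω => ⟨by simpa [pastPart_of_lt hlt] using hω.2, hω.1⟩

lemma frequently_mem_mem_self (h : LocationScale P y ε) (s t : ℤ) {I : Set ℝ}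
    (hI : IsOpen I) (hIne : I.Nonempty) : ∃ᶠ ω in ae P, y s ω ∈ I ∧ y t ω ∈ I := by
  rcases eq_or_ne s t with rfl | hst
  · exact (h.frequently_mem s hI hIne).mono fun ω hω => ⟨hω, hω⟩
  · exact h.frequently_mem_mem hst hI hIne hI hIne

end LocationScale

section Forms

variable {p : ℕ}

lemma quadVar_eq_linMean (α : Fin (p + 1) → ℝ) (x : ℤ → ℝ) (t : ℤ) :
    quadVar α x t = linMean α (fun s => x s ^ 2) t := rfl

lemma measurable_linMean (φ : Fin (p + 1) → ℝ) (t : ℤ) : Measurable fun x => linMean φ x t := by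
  unfold linMean
  fun_prop

lemma measurable_quadVar (α : Fin (p + 1) → ℝ) (t : ℤ) : Measurable fun x => quadVar α x t := by
  unfold quadVar
  fun_prop

lemma linMean_pastPart (φ : Fin (p + 1) → ℝ) (x : ℤ → ℝ) (t : ℤ) :
    linMean φ (pastPart t x) t = linMean φ x t := by
  have h : ∀ i : Fin p, pastPart t x (t - ((i : ℤ) + 1)) = x (t - ((i : ℤ) + 1)) :=
    fun i => pastPart_of_lt (by omega) x
  simp only [linMean, h]

lemma pastPart_sq (t : ℤ) (x : ℤ → ℝ) :
    (fun s => pastPart t x s ^ 2) = pastPart t fun s => x s ^ 2 := by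
  funext s
  unfold pastPart
  split_ifs <;> simp

lemma quadVar_pastPart (α : Fin (p + 1) → ℝ) (x : ℤ → ℝ) (t : ℤ) :
    quadVar α (pastPart t x) t = quadVar α x t := by
  rw [quadVar_eq_linMean, pastPart_sq, linMean_pastPart, quadVar_eq_linMean]

/-- A linear form whose first nonzero lag coefficient is that of lag `i + 1` is the sum of that
lag's term and of a function of the strictly earlier past. -/
lemma linMean_eq_pastPart_add (c : Fin (p + 1) → ℝ) (x : ℤ → ℝ) (t : ℤ) (i : Fin p)
    (hi : ∀ j < i, c j.succ = 0) :
    linMean c x t = linMean c (pastPart (t - ((i : ℤ) + 1)) x) t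
      + c i.succ * x (t - ((i : ℤ) + 1)) := by
  unfold linMean
  rw [add_assoc, ← Finset.sum_erase_add _ _ (Finset.mem_univ i),
    ← Finset.sum_erase_add _ _ (Finset.mem_univ i)]
  have h0 : pastPart (t - ((i : ℤ) + 1)) x (t - ((i : ℤ) + 1)) = 0 := if_neg (lt_irrefl _)
  rw [h0, mul_zero, add_zero]
  congr 2
  refine Finset.sum_congr rfl fun j hj => ?_
  rcases lt_or_gt_of_ne (Finset.ne_of_mem_erase hj) with hlt | hlt
  · simp [hi j hlt]
  · rw [pastPart_of_lt]
    have : (i : ℕ) < j := hlt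
    omega

lemma exists_first_lag {c : Fin (p + 1) → ℝ} (h : ∃ i : Fin p, c i.succ ≠ 0) :
    ∃ i : Fin p, c i.succ ≠ 0 ∧ ∀ j < i, c j.succ = 0 := by
  obtain ⟨i, hi, hmin⟩ := WellFounded.has_min (wellFounded_lt (α := Fin p))
    {i | c i.succ ≠ 0} h
  exact ⟨i, hi, fun j hj => by_contra fun hc => hmin j hc hj⟩

lemma linMean_of_lags_eq_zero {c : Fin (p + 1) → ℝ} (h : ∀ i : Fin p, c i.succ = 0) (x : ℤ → ℝ)
    (t : ℤ) : linMean c x t = c 0 := by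
  simp [linMean, h]

variable {Ω : Type*} [MeasurableSpace Ω] {P : Measure Ω} [IsProbabilityMeasure P]
  {y ε : ℤ → Ω → ℝ}

/-- Nonzero linear forms in the past observations almost surely do not vanish. -/
lemma LocationScale.ae_linMean_ne_zero (h : LocationScale P y ε) {c : Fin (p + 1) → ℝ}
    (hc : c ≠ 0) (t : ℤ) : ∀ᵐ ω ∂P, linMean c (fun s => y s ω) t ≠ 0 := by
  by_cases hl : ∃ i : Fin p, c i.succ ≠ 0
  · obtain ⟨i, hi, hmin⟩ := exists_first_lag hl
    filter_upwards [h.ae_ne (t - ((i : ℤ) + 1)) (W := fun z => -linMean c z t / c i.succ)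
      ((measurable_linMean c t).neg.div_const _)] with ω hω h0
    rw [linMean_eq_pastPart_add c _ t i hmin] at h0
    refine hω ?_
    rw [eq_div_iff hi]
    linarith
  · push Not at hl
    refine Eventually.of_forall fun ω h0 => hc ?_
    rw [linMean_of_lags_eq_zero hl] at h0
    funext i
    refine Fin.cases h0 hl i

/-- Nonzero linear forms in the squared past observations almost surely do not vanish. -/
lemma LocationScale.ae_quadVar_ne_zero (h : LocationScale P y ε) {c : Fin (p + 1) → ℝ}
    (hc : c ≠ 0) (t : ℤ) : ∀ᵐ ω ∂P, quadVar c (fun s => y s ω) t ≠ 0 := by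
  by_cases hl : ∃ i : Fin p, c i.succ ≠ 0
  · obtain ⟨i, hi, hmin⟩ := exists_first_lag hl
    have hm : Measurable fun z => √(-quadVar c z t / c i.succ) :=
      ((measurable_quadVar c t).neg.div_const _).sqrt
    filter_upwards [h.ae_ne (t - ((i : ℤ) + 1)) hm, h.ae_ne (t - ((i : ℤ) + 1)) hm.neg]
      with ω h1 h2 h0
    rw [quadVar_eq_linMean, linMean_eq_pastPart_add c _ t i hmin, ← pastPart_sq,
      ← quadVar_eq_linMean] at h0
    have hsq : y (t - ((i : ℤ) + 1)) ω ^ 2 =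
        -quadVar c (pastPart (t - ((i : ℤ) + 1)) fun s => y s ω) t / c i.succ := by
      rw [eq_div_iff hi]
      linarith
    rw [← hsq, Real.sqrt_sq_eq_abs] at h1
    simp only [Pi.neg_apply] at h2
    rw [← hsq, Real.sqrt_sq_eq_abs] at h2
    -- the observation would be one of the two square roots of a function of its past
    rcases abs_choice (y (t - ((i : ℤ) + 1)) ω) with h3 | h3
    · exact h1 h3.symm
    · exact h2 (by rw [h3, neg_neg])
  · push Not at hl
    refine Eventually.of_forall fun ω h0 => hc ?_
    rw [quadVar_eq_linMean, linMean_of_lags_eq_zero hl] at h0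
    funext i
    refine Fin.cases h0 hl i

end Forms

/-! ### Identifiability -/

section Identification

variable {p : ℕ} {Ω : Type*} [MeasurableSpace Ω] {P : Measure Ω} [IsProbabilityMeasure P]
  {y ε : ℤ → Ω → ℝ}

/-- The conditional mean at time `0` in the regime determined by the infinite past. -/
noncomputable def bufferMean (θ : Param p) (x : ℤ → ℝ) : ℝ :=
  condMean θ (bufferRegime θ.rL θ.rU θ.delay x 0) x 0

/-- The conditional variance at time `0` in the regime determined by the infinite past. -/
noncomputable def bufferVar (θ : Param p) (x : ℤ → ℝ) : ℝ :=
  condVar θ (bufferRegime θ.rL θ.rU θ.delay x 0) x 0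

lemma bufferRegime_of_le {rL rU : ℝ} {d : ℕ} {x : ℤ → ℝ} {t : ℤ} (h : x (t - d) ≤ rL) :
    bufferRegime rL rU d x t = true := by
  rw [bufferRegime_succ, switch, if_pos h]

lemma bufferRegime_of_lt {rL rU : ℝ} {d : ℕ} {x : ℤ → ℝ} {t : ℤ} (hLU : rL ≤ rU)
    (h : rU < x (t - d)) : bufferRegime rL rU d x t = false := by
  rw [bufferRegime_succ, switch, if_neg (by linarith), if_pos h]

lemma bufferRegime_of_lt_pred {rL rU : ℝ} {d : ℕ} {x : ℤ → ℝ} {t : ℤ} (hLU : rL ≤ rU)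
    (h : rL < x (t - d)) (h' : rU < x (t - 1 - d)) : bufferRegime rL rU d x t = false := by
  rw [bufferRegime_succ, bufferRegime_of_lt hLU h', switch, if_neg (by linarith), ite_self]

lemma bufferRegime_of_le_pred {rL rU : ℝ} {d : ℕ} {x : ℤ → ℝ} {t : ℤ}
    (h : x (t - d) ≤ rU) (h' : x (t - 1 - d) ≤ rL) : bufferRegime rL rU d x t = true := by
  rw [bufferRegime_succ, bufferRegime_of_le h', switch, if_neg (not_lt.2 h), ite_self]

/-- If the regimes at time `0` agree almost surely, the lower boundaries are not ordered strictly: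
for a threshold variable between the two, preceded by one above `rU`, the regimes differ. -/
lemma LocationScale.not_rL_lt (h : LocationScale P y ε) {rL rU rL' rU' : ℝ} {d : ℕ}
    (hLU : rL ≤ rU)
    (heq : ∀ᵐ ω ∂P, bufferRegime rL rU d (fun s => y s ω) 0 =
      bufferRegime rL' rU' d (fun s => y s ω) 0) : ¬ rL < rL' := by
  intro hlt
  obtain ⟨ω, ⟨h1, h2⟩, h3⟩ := ((h.frequently_mem_mem (s := 0 - (d : ℤ)) (t := 0 - 1 - (d : ℤ))
    (by omega) isOpen_Ioo (Set.nonempty_Ioo.2 hlt) (isOpen_Ioi (a := rU))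
    Set.nonempty_Ioi).and_eventually heq).exists
  rw [bufferRegime_of_lt_pred hLU h1.1 h2, bufferRegime_of_le h1.2.le] at h3
  exact Bool.false_ne_true h3

/-- The analogue for the upper boundary, after an observation below `rL'`. -/
lemma LocationScale.not_rU_lt (h : LocationScale P y ε) {rL rU rL' rU' : ℝ} {d : ℕ}
    (hLU : rL ≤ rU)
    (heq : ∀ᵐ ω ∂P, bufferRegime rL rU d (fun s => y s ω) 0 =
      bufferRegime rL' rU' d (fun s => y s ω) 0) : ¬ rU < rU' := by
  intro hlt
  obtain ⟨ω, ⟨h1, h2⟩, h3⟩ := ((h.frequently_mem_mem (s := 0 - (d : ℤ)) (t := 0 - 1 - (d : ℤ))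
    (by omega) isOpen_Ioo (Set.nonempty_Ioo.2 hlt) (isOpen_Iio (a := rL'))
    Set.nonempty_Iio).and_eventually heq).exists
  rw [bufferRegime_of_lt hLU h1.1,
    bufferRegime_of_le_pred h1.2.le (le_of_lt h2)] at h3
  exact Bool.false_ne_true h3

/-- The parameter is identified by the conditional mean and variance at time `0`. Paths far below
and far above the buffer zone identify the coefficients of the two regimes; since these differ,
the regime itself is identified, and it determines the delay and the boundaries. -/
lemma LocationScale.eq_of_ae_eq (h : LocationScale P y ε) {θ θ₀ : Param p}
    (hLU : θ.rL ≤ θ.rU) (hLU₀ : θ₀.rL ≤ θ₀.rU) (hne : θ₀.coef.1.1 ≠ θ₀.coef.2.1)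
    (hmean : ∀ᵐ ω ∂P, bufferMean θ (fun s => y s ω) = bufferMean θ₀ fun s => y s ω)
    (hvar : ∀ᵐ ω ∂P, bufferVar θ (fun s => y s ω) = bufferVar θ₀ fun s => y s ω) : θ = θ₀ := by
  have hreg : ∀ R, ∃ᶠ ω in ae P,
      bufferRegime θ.rL θ.rU θ.delay (fun s => y s ω) 0 = R ∧
        bufferRegime θ₀.rL θ₀.rU θ₀.delay (fun s => y s ω) 0 = R := by
    rintro (_ | _)
    · refine (h.frequently_mem_mem_self (0 - (θ.delay : ℤ)) (0 - (θ₀.delay : ℤ))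
        (isOpen_Ioi (a := max θ.rU θ₀.rU)) Set.nonempty_Ioi).mono fun ω hω => ?_
      exact ⟨bufferRegime_of_lt hLU ((le_max_left _ _).trans_lt hω.1),
        bufferRegime_of_lt hLU₀ ((le_max_right _ _).trans_lt hω.2)⟩
    · refine (h.frequently_mem_mem_self (0 - (θ.delay : ℤ)) (0 - (θ₀.delay : ℤ))
        (isOpen_Iio (a := min θ.rL θ₀.rL)) Set.nonempty_Iio).mono fun ω hω => ?_
      exact ⟨bufferRegime_of_le ((le_of_lt hω.1).trans (min_le_left _ _)),
        bufferRegime_of_le ((le_of_lt hω.2).trans (min_le_right _ _))⟩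
  have hcoef : ∀ R, θ.regime R = θ₀.regime R := by
    intro R
    refine Prod.ext (by_contra fun hc => ?_) (by_contra fun hc => ?_)
    · obtain ⟨ω, ⟨⟨h1, h2⟩, h3⟩, h4⟩ := (((hreg R).and_eventually hmean).and_eventually
        (h.ae_linMean_ne_zero (sub_ne_zero.2 hc) 0)).exists
      rw [bufferMean, bufferMean, h1, h2] at h3
      exact h4 (by rw [← linMean_sub]; exact sub_eq_zero.2 h3)
    · obtain ⟨ω, ⟨⟨h1, h2⟩, h3⟩, h4⟩ := (((hreg R).and_eventually hvar).and_eventually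
        (h.ae_quadVar_ne_zero (sub_ne_zero.2 hc) 0)).exists
      rw [bufferVar, bufferVar, h1, h2] at h3
      exact h4 (by rw [← quadVar_sub]; exact sub_eq_zero.2 h3)
  have hsame : ∀ᵐ ω ∂P, bufferRegime θ.rL θ.rU θ.delay (fun s => y s ω) 0 =
      bufferRegime θ₀.rL θ₀.rU θ₀.delay (fun s => y s ω) 0 := by
    filter_upwards [hmean, h.ae_linMean_ne_zero (sub_ne_zero.2 hne) 0] with ω h1 h2
    rw [← linMean_sub, sub_ne_zero] at h2
    by_contra hR
    simp only [bufferMean, condMean, hcoef] at h1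
    revert h1 hR
    cases bufferRegime θ.rL θ.rU θ.delay (fun s => y s ω) 0 <;>
      cases bufferRegime θ₀.rL θ₀.rU θ₀.delay (fun s => y s ω) 0
    · simp
    · exact fun _ h1 => h2 h1.symm
    · exact fun _ h1 => h2 h1
    · simp
  have hd : θ.delay = θ₀.delay := by
    by_contra hd
    obtain ⟨ω, ⟨h1, h2⟩, h3⟩ := ((h.frequently_mem_mem (s := 0 - (θ.delay : ℤ))
      (t := 0 - (θ₀.delay : ℤ)) (by omega) (isOpen_Iio (a := θ.rL)) Set.nonempty_Iio
      (isOpen_Ioi (a := θ₀.rU)) Set.nonempty_Ioi).and_eventually hsame).exists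
    rw [bufferRegime_of_le (le_of_lt h1), bufferRegime_of_lt hLU₀ h2] at h3
    exact Bool.false_ne_true h3.symm
  rw [hd] at hsame
  have hsame' := hsame.mono fun _ hω => hω.symm
  have hL : θ.rL = θ₀.rL :=
    le_antisymm (not_lt.1 (h.not_rL_lt hLU₀ hsame')) (not_lt.1 (h.not_rL_lt hLU hsame))
  have hU : θ.rU = θ₀.rU :=
    le_antisymm (not_lt.1 (h.not_rU_lt hLU₀ hsame')) (not_lt.1 (h.not_rU_lt hLU hsame))
  have hc : θ.coef = θ₀.coef := Prod.ext (hcoef true) (hcoef false)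
  exact Prod.ext hc (Prod.ext hL (Prod.ext hU hd))

end Identification

/-! ### Integrability -/

section Select

variable {Ω : Type*}

lemma select_eq (ρ : Ω → Bool) (f : Bool → Ω → ℝ) :
    (fun ω => f (ρ ω) ω) =
      (ρ ⁻¹' {true}).indicator (f true) + (ρ ⁻¹' {false}).indicator (f false) := by
  funext ω
  cases h : ρ ω <;> simp [Set.indicator, h]

variable [MeasurableSpace Ω] {P : Measure Ω} {ρ : Ω → Bool} {f : Bool → Ω → ℝ}

lemma measurable_select (hρ : Measurable ρ) (hf : ∀ R, Measurable (f R)) :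
    Measurable fun ω => f (ρ ω) ω := by
  rw [select_eq]
  exact ((hf true).indicator (hρ (measurableSet_singleton _))).add
    ((hf false).indicator (hρ (measurableSet_singleton _)))

lemma memLp_select {q : ENNReal} (hρ : Measurable ρ) (hf : ∀ R, MemLp (f R) q P) :
    MemLp (fun ω => f (ρ ω) ω) q P := by
  rw [select_eq]
  exact ((hf true).indicator (hρ (measurableSet_singleton _))).add
    ((hf false).indicator (hρ (measurableSet_singleton _)))

lemma integrable_select (hρ : Measurable ρ) (hf : ∀ R, Integrable (f R) P) :
    Integrable (fun ω => f (ρ ω) ω) P := by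
  rw [← memLp_one_iff_integrable]
  exact memLp_select hρ fun R => memLp_one_iff_integrable.2 (hf R)

/-- The quotient of an integrable function by a function bounded below by a positive constant is
integrable. -/
lemma integrable_div_of_le {u v : Ω → ℝ} {m : ℝ} (hm : 0 < m) (hv : Measurable v)
    (hui : Integrable u P) (hmv : ∀ ω, m ≤ v ω) : Integrable (fun ω => u ω / v ω) P := by
  refine (hui.abs.div_const m).mono' (hui.aestronglyMeasurable.div₀ hv.aestronglyMeasurable)
    (Eventually.of_forall fun ω => ?_)
  have hpos := hm.trans_le (hmv ω)
  rw [Real.norm_eq_abs, abs_div, abs_of_pos hpos]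
  exact div_le_div_of_nonneg_left (abs_nonneg _) hm (hmv ω)

end Select

section Integrability

variable {p : ℕ}

lemma measurable_regimeLoss (c : RegimeCoef p) (t : ℤ) : Measurable fun x => regimeLoss c x t := by
  have h1 := measurable_quadVar c.2 t
  have h2 := measurable_linMean c.1 t
  unfold regimeLoss
  fun_prop

lemma measurable_lossModulus (m : ℝ) (c : RegimeCoef p) (t : ℤ) :
    Measurable fun x => lossModulus m c x t := by
  have h2 := measurable_linMean c.1 t
  have h3 : Measurable fun x => absSum p x t := by
    unfold absSum
    fun_prop
  unfold lossModulus
  fun_prop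

lemma measurable_bufferLoss (θ : Param p) : Measurable fun x => bufferLoss θ x 0 :=
  measurable_select (f := fun R x => regimeLoss (θ.regime R) x 0)
    (measurable_bufferRegime θ.rL θ.rU θ.delay 0) fun _ => measurable_regimeLoss _ 0

lemma measurable_bufferMean (θ : Param p) : Measurable (bufferMean θ) :=
  measurable_select (f := fun R x => condMean θ R x 0)
    (measurable_bufferRegime θ.rL θ.rU θ.delay 0) fun _ => measurable_linMean _ 0

lemma measurable_bufferVar (θ : Param p) : Measurable (bufferVar θ) :=
  measurable_select (f := fun R x => condVar θ R x 0)
    (measurable_bufferRegime θ.rL θ.rU θ.delay 0) fun _ => measurable_quadVar _ 0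

lemma measurable_minorant (m : ℝ) (θ : Param p) (δ : ℝ) : Measurable (minorant m θ δ) := by
  have h1 := measurable_bufferLoss θ
  refine (h1.sub (((measurable_lossModulus m _ 0).add
    (measurable_lossModulus m _ 0)).const_mul δ)).sub (Measurable.ite ?_ measurable_const ?_)
  · exact measurableSet_eq_fun (measurable_bufferRegime _ _ _ 0) (measurable_bufferRegime _ _ _ 0)
  · exact h1.abs.add_const _

lemma le_bufferVar {m : ℝ} (hm : 0 < m) {θ : Param p} (h : VarBound m θ) (x : ℤ → ℝ) :
    m ≤ bufferVar θ x := le_quadVar hm.le (h _) x 0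

lemma bufferMean_pastPart {θ : Param p} (hd : 1 ≤ θ.delay) (x : ℤ → ℝ) :
    bufferMean θ (pastPart 0 x) = bufferMean θ x := by
  rw [bufferMean, bufferMean, bufferRegime_congr hd fun s hs => pastPart_of_lt hs x]
  exact linMean_pastPart _ x 0

lemma bufferVar_pastPart {θ : Param p} (hd : 1 ≤ θ.delay) (x : ℤ → ℝ) :
    bufferVar θ (pastPart 0 x) = bufferVar θ x := by
  rw [bufferVar, bufferVar, bufferRegime_congr hd fun s hs => pastPart_of_lt hs x]
  exact quadVar_pastPart _ x 0

variable {Ω : Type*} [MeasurableSpace Ω] {P : Measure Ω} [IsProbabilityMeasure P]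
  {y : ℤ → Ω → ℝ}

lemma memLp_linMean (hmom : ∀ t, MemLp (y t) 2 P) (φ : Fin (p + 1) → ℝ) (t : ℤ) :
    MemLp (fun ω => linMean φ (fun s => y s ω) t) 2 P := by
  have h : MemLp (fun ω => ∑ i : Fin p, φ i.succ * y (t - ((i : ℤ) + 1)) ω) 2 P :=
    memLp_finsetSum _ fun i _ => (hmom _).const_mul _
  exact (memLp_const (φ 0)).add h

lemma memLp_absSum (hmom : ∀ t, MemLp (y t) 2 P) (t : ℤ) :
    MemLp (fun ω => absSum p (fun s => y s ω) t) 2 P := by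
  have h : MemLp (fun ω => ∑ i : Fin p, |y (t - ((i : ℤ) + 1)) ω|) 2 P :=
    memLp_finsetSum _ fun i _ => by
      simpa only [Real.norm_eq_abs] using (hmom (t - ((i : ℤ) + 1))).norm
  have h1 : MemLp (fun _ : Ω => (1 : ℝ)) 2 P := memLp_const 1
  exact h1.add h

lemma integrable_quadVar (hmom : ∀ t, MemLp (y t) 2 P) (α : Fin (p + 1) → ℝ) (t : ℤ) :
    Integrable (fun ω => quadVar α (fun s => y s ω) t) P := by
  unfold quadVar
  exact (integrable_const _).add
    (integrable_finsetSum _ fun i _ => (hmom _).integrable_sq.const_mul _)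

lemma memLp_bufferMean (hmom : ∀ t, MemLp (y t) 2 P) (hy : ∀ t, Measurable (y t)) (θ : Param p) :
    MemLp (fun ω => bufferMean θ fun s => y s ω) 2 P :=
  memLp_select (f := fun R ω => condMean θ R (fun s => y s ω) 0)
    ((measurable_bufferRegime θ.rL θ.rU θ.delay 0).comp (measurable_pi_lambda _ hy))
    fun _ => memLp_linMean hmom _ 0

lemma integrable_bufferVar (hmom : ∀ t, MemLp (y t) 2 P) (hy : ∀ t, Measurable (y t))
    (θ : Param p) : Integrable (fun ω => bufferVar θ fun s => y s ω) P :=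
  integrable_select (f := fun R ω => condVar θ R (fun s => y s ω) 0)
    ((measurable_bufferRegime θ.rL θ.rU θ.delay 0).comp (measurable_pi_lambda _ hy))
    fun _ => integrable_quadVar hmom _ 0

/-- The logarithm of an integrable function bounded below by a positive constant is integrable. -/
lemma integrable_log_of_le {v : Ω → ℝ} {m : ℝ} (hm : 0 < m) (hv : Measurable v)
    (hvi : Integrable v P) (hmv : ∀ ω, m ≤ v ω) : Integrable (fun ω => Real.log (v ω)) P := by
  refine ((integrable_const |Real.log m|).add hvi).mono' hv.log.aestronglyMeasurable
    (Eventually.of_forall fun ω => ?_)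
  have hpos := hm.trans_le (hmv ω)
  have h1 := Real.log_le_log hm (hmv ω)
  have h2 := Real.log_le_sub_one_of_pos hpos
  change |Real.log (v ω)| ≤ |Real.log m| + v ω
  rw [abs_le]
  constructor
  · linarith [neg_abs_le (Real.log m)]
  · linarith [abs_nonneg (Real.log m)]

lemma integrable_bufferLoss (hmom : ∀ t, MemLp (y t) 2 P) (hy : ∀ t, Measurable (y t)) {m : ℝ}
    (hm : 0 < m) {θ : Param p} (h : VarBound m θ) :
    Integrable (fun ω => bufferLoss θ (fun s => y s ω) 0) P := by
  have hv : Measurable fun ω => bufferVar θ fun s => y s ω :=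
    (measurable_bufferVar θ).comp (measurable_pi_lambda _ hy)
  exact (integrable_log_of_le hm hv (integrable_bufferVar hmom hy θ)
    fun ω => le_bufferVar hm h _).add (integrable_div_of_le hm hv
      ((hmom 0).sub (memLp_bufferMean hmom hy θ)).integrable_sq fun ω => le_bufferVar hm h _)

lemma integrable_lossModulus (hmom : ∀ t, MemLp (y t) 2 P) (m : ℝ) (c : RegimeCoef p) :
    Integrable (fun ω => lossModulus m c (fun s => y s ω) 0) P := by
  have hu := (hmom 0).sub (memLp_linMean hmom c.1 0)
  have h1 := ((hu.abs.integrable_mul (memLp_absSum (p := p) hmom 0)).const_mul 2).div_const m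
  refine ((integrable_const _).add (h1.congr (Eventually.of_forall fun ω => ?_))).add
    (hu.integrable_sq.div_const _)
  simp only [Pi.mul_apply, Pi.abs_apply, Pi.sub_apply]
  ring

/-- A bound for all the minorants with `δ ≤ 1`. -/
lemma abs_minorant_le {m δ : ℝ} (hm : 0 < m) (h0 : 0 ≤ δ) (h1 : δ ≤ 1) (θ : Param p)
    (x : ℤ → ℝ) : |minorant m θ δ x| ≤ |bufferLoss θ x 0|
      + (lossModulus m (θ.regime true) x 0 + lossModulus m (θ.regime false) x 0)
      + (|bufferLoss θ x 0| + |Real.log m|) := by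
  have hK := add_nonneg (lossModulus_nonneg hm (θ.regime true) x 0)
    (lossModulus_nonneg hm (θ.regime false) x 0)
  unfold minorant
  refine (abs_sub _ _).trans (add_le_add ((abs_sub _ _).trans (add_le_add le_rfl ?_)) ?_)
  · rw [abs_mul, abs_of_nonneg h0, abs_of_nonneg hK]
    exact mul_le_of_le_one_left hK h1
  · have : 0 ≤ |bufferLoss θ x 0| + |Real.log m| := by positivity
    split_ifs
    · simpa using this
    · rw [abs_of_nonneg this]

lemma integrable_minorant_bound (hmom : ∀ t, MemLp (y t) 2 P) (hy : ∀ t, Measurable (y t)) {m : ℝ}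
    (hm : 0 < m) {θ : Param p} (h : VarBound m θ) :
    Integrable (fun ω => |bufferLoss θ (fun s => y s ω) 0|
      + (lossModulus m (θ.regime true) (fun s => y s ω) 0
        + lossModulus m (θ.regime false) (fun s => y s ω) 0)
      + (|bufferLoss θ (fun s => y s ω) 0| + |Real.log m|)) P := by
  have h1 := (integrable_bufferLoss hmom hy hm h).abs
  exact (h1.add ((integrable_lossModulus hmom m _).add (integrable_lossModulus hmom m _))).add
    (h1.add (integrable_const _))

lemma integrable_minorant (hmom : ∀ t, MemLp (y t) 2 P) (hy : ∀ t, Measurable (y t)) {m δ : ℝ}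
    (hm : 0 < m) (h0 : 0 ≤ δ) (h1 : δ ≤ 1) {θ : Param p} (h : VarBound m θ) :
    Integrable (fun ω => minorant m θ δ fun s => y s ω) P :=
  (integrable_minorant_bound hmom hy hm h).mono'
    ((measurable_minorant m θ δ).comp (measurable_pi_lambda _ hy)).aestronglyMeasurable
    (Eventually.of_forall fun _ => abs_minorant_le hm h0 h1 θ _)

/-- The means of the minorants over shrinking neighbourhoods of `θ` converge to the mean loss at
`θ`, since observations almost surely avoid the boundaries of the buffer zone. -/
lemma tendsto_integral_minorant {ε : ℤ → Ω → ℝ} (hls : LocationScale P y ε)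
    (hmom : ∀ t, MemLp (y t) 2 P) {m : ℝ} (hm : 0 < m) {θ : Param p} (h : VarBound m θ)
    {a b : ℝ} (ha : a ≤ θ.rL) (hb : θ.rU ≤ b)
    (hrec : ∀ᵐ ω ∂P, ∀ N : ℕ, ∃ n ≥ N, y (-(n : ℤ)) ω ∉ Set.Icc a b) :
    Tendsto (fun k : ℕ => ∫ ω, minorant m θ (1 / ((k : ℝ) + 1)) (fun s => y s ω) ∂P) atTop
      (𝓝 (∫ ω, bufferLoss θ (fun s => y s ω) 0 ∂P)) := by
  have hδ := tendsto_one_div_add_atTop_nhds_zero_nat (𝕜 := ℝ)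
  have hδ' : Tendsto (fun k : ℕ => -(1 / ((k : ℝ) + 1))) atTop (𝓝 0) := by simpa using hδ.neg
  refine tendsto_integral_of_dominated_convergence _ (fun k =>
    ((measurable_minorant m θ _).comp hls.measurable_path).aestronglyMeasurable)
    (integrable_minorant_bound hmom hls.measurable_y hm h) (fun k => Eventually.of_forall fun _ =>
      abs_minorant_le hm (by positivity) ?_ θ _) ?_
  · rw [div_le_one (by positivity)]
    linarith [(Nat.cast_nonneg k : (0 : ℝ) ≤ k)]
  have hneL : ∀ᵐ ω ∂P, ∀ s, y s ω ≠ θ.rL :=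
    ae_all_iff.2 fun s => hls.ae_ne s (W := fun _ => θ.rL) measurable_const
  have hneU : ∀ᵐ ω ∂P, ∀ s, y s ω ≠ θ.rU :=
    ae_all_iff.2 fun s => hls.ae_ne s (W := fun _ => θ.rU) measurable_const
  filter_upwards [hneL, hneU, hrec] with ω h1 h2 h3
  obtain ⟨n, hn, hy⟩ := h3 θ.delay
  have hev := eventually_bufferRegime_eq (x := fun s => y s ω) (d := θ.delay) (t := 0)
    (s := -(n : ℤ) + θ.delay) ha hb (fun s => ⟨h1 s, h2 s⟩) (by simpa using hy) (by omega)
  have hlim : Tendsto (fun k : ℕ => bufferLoss θ (fun s => y s ω) 0 - 1 / ((k : ℝ) + 1) *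
      (lossModulus m (θ.regime true) (fun s => y s ω) 0
        + lossModulus m (θ.regime false) (fun s => y s ω) 0)) atTop
      (𝓝 (bufferLoss θ (fun s => y s ω) 0)) := by
    simpa using tendsto_const_nhds.sub (hδ.mul_const
      (lossModulus m (θ.regime true) (fun s => y s ω) 0
        + lossModulus m (θ.regime false) (fun s => y s ω) 0))
  refine hlim.congr' ?_
  filter_upwards [hδ.eventually hev, hδ'.eventually hev] with k hk hk'
  rw [minorant, hk, hk', if_pos rfl, sub_zero]

end Integrability

/-! ### The mean loss is minimal at the true parameter only -/

section Contrast

variable {p : ℕ} {Ω : Type*} [MeasurableSpace Ω] {P : Measure Ω} [IsProbabilityMeasure P]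
  {y ε : ℤ → Ω → ℝ}

/-- The conditional expectation of the loss at `θ` given the past, when the true parameter is
`θ₀`. -/
noncomputable def condLoss (θ θ₀ : Param p) (x : ℤ → ℝ) : ℝ :=
  Real.log (bufferVar θ x) + (bufferMean θ₀ x - bufferMean θ x) ^ 2 / bufferVar θ x
    + bufferVar θ₀ x / bufferVar θ x

lemma integrable_condLoss (hmom : ∀ t, MemLp (y t) 2 P) (hy : ∀ t, Measurable (y t)) {m : ℝ}
    (hm : 0 < m) {θ θ₀ : Param p} (h : VarBound m θ) :
    Integrable (fun ω => condLoss θ θ₀ fun s => y s ω) P := by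
  have hv : Measurable fun ω => bufferVar θ fun s => y s ω :=
    (measurable_bufferVar θ).comp (measurable_pi_lambda _ hy)
  have hb : ∀ ω, m ≤ bufferVar θ fun s => y s ω := fun ω => le_bufferVar hm h _
  exact ((integrable_log_of_le hm hv (integrable_bufferVar hmom hy θ) hb).add
    (integrable_div_of_le hm hv ((memLp_bufferMean hmom hy θ₀).sub
      (memLp_bufferMean hmom hy θ)).integrable_sq hb)).add
    (integrable_div_of_le hm hv (integrable_bufferVar hmom hy θ₀) hb)

/-- The loss and its conditional expectation have the same mean: they differ by a combination of
`ε` and `ε² - 1`, which are centred, with weights determined by the past. -/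
lemma integral_bufferLoss (hls : LocationScale P y ε) (hε : IsInnovation P ε)
    (hmom : ∀ t, MemLp (y t) 2 P) {m : ℝ} (hm : 0 < m) {θ θ₀ : Param p} (h : VarBound m θ)
    (h₀ : VarBound m θ₀) (hd : 1 ≤ θ.delay) (hd₀ : 1 ≤ θ₀.delay)
    (hobs : ∀ᵐ ω ∂P, y 0 ω = bufferMean θ₀ (fun s => y s ω)
      + ε 0 ω * √(bufferVar θ₀ fun s => y s ω)) :
    ∫ ω, bufferLoss θ (fun s => y s ω) 0 ∂P = ∫ ω, condLoss θ θ₀ (fun s => y s ω) ∂P := by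
  have hy := hls.measurable_y
  have hmp := hls.measurable_path
  have hb : ∀ ω, m ≤ bufferVar θ fun s => y s ω := fun ω => le_bufferVar hm h _
  have hb₀ : ∀ ω, m ≤ bufferVar θ₀ fun s => y s ω := fun ω => le_bufferVar hm h₀ _
  have hv : Measurable fun ω => bufferVar θ fun s => y s ω := (measurable_bufferVar θ).comp hmp
  -- the weights of `ε` and `ε² - 1` in the loss, as functions of the path
  set g : (ℤ → ℝ) → ℝ := fun x =>
    2 * (bufferMean θ₀ x - bufferMean θ x) * √(bufferVar θ₀ x) / bufferVar θ x with hg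
  set k : (ℤ → ℝ) → ℝ := fun x => bufferVar θ₀ x / bufferVar θ x with hk
  have m1 := measurable_bufferMean θ
  have m2 := measurable_bufferMean θ₀
  have m3 := measurable_bufferVar θ
  have m4 := measurable_bufferVar θ₀
  have hgm : Measurable g := by fun_prop
  have hkm : Measurable k := by fun_prop
  have hgp : ∀ x, g (pastPart 0 x) = g x := fun x => by
    simp only [hg, bufferMean_pastPart hd, bufferMean_pastPart hd₀, bufferVar_pastPart hd,
      bufferVar_pastPart hd₀]
  have hkp : ∀ x, k (pastPart 0 x) = k x := fun x => by
    simp only [hk, bufferVar_pastPart hd, bufferVar_pastPart hd₀]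
  have ki : Integrable (fun ω => k fun s => y s ω) P :=
    integrable_div_of_le hm hv (integrable_bufferVar hmom hy θ₀) hb
  have qi : Integrable (fun ω => (bufferMean θ₀ (fun s => y s ω)
      - bufferMean θ (fun s => y s ω)) ^ 2 / bufferVar θ (fun s => y s ω)) P :=
    integrable_div_of_le hm hv ((memLp_bufferMean hmom hy θ₀).sub
      (memLp_bufferMean hmom hy θ)).integrable_sq hb
  have gi : Integrable (fun ω => g fun s => y s ω) P := by
    refine (qi.add ki).mono' (hgm.comp hmp).aestronglyMeasurable (Eventually.of_forall fun ω => ?_)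
    have hpos := hm.trans_le (hb ω)
    simp only [hg, hk, Pi.add_apply, Real.norm_eq_abs]
    rw [abs_div, abs_of_pos hpos, ← add_div]
    refine div_le_div_of_nonneg_right ?_ hpos.le
    have hs := Real.sq_sqrt (hm.le.trans (hb₀ ω))
    rw [abs_le]
    constructor
    · nlinarith [sq_nonneg (bufferMean θ₀ (fun s => y s ω) - bufferMean θ (fun s => y s ω)
        + √(bufferVar θ₀ fun s => y s ω))]
    · nlinarith [sq_nonneg (bufferMean θ₀ (fun s => y s ω) - bufferMean θ (fun s => y s ω)
        - √(bufferVar θ₀ fun s => y s ω))]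
  have ind : ∀ {f : (ℤ → ℝ) → ℝ} {e : ℝ → ℝ}, Measurable f → Measurable e →
      (∀ x, f (pastPart 0 x) = f x) →
      IndepFun (fun ω => e (ε 0 ω)) (fun ω => f fun s => y s ω) P := by
    intro f e hf he hfp
    have := ((hls.indep 0).comp hf he).symm
    simpa only [Function.comp_def, hfp] using this
  have ε1 : Integrable (ε 0) P := (hε.memLp 0).integrable (by norm_num)
  have ε2 : Integrable (fun ω => ε 0 ω ^ 2) P := (hε.memLp 0).integrable_sq
  have εsq : ∫ ω, ε 0 ω ^ 2 ∂P = 1 := by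
    rw [← hε.variance 0, variance_of_integral_eq_zero
      (hls.measurable_innov 0).aemeasurable (hε.mean 0)]
  have ind1 := ind (e := fun z => z) hgm measurable_id hgp
  have ind2 := ind (e := fun z => z ^ 2 - 1) hkm (by fun_prop) hkp
  have ε3 : Integrable (fun ω => ε 0 ω ^ 2 - 1) P := ε2.sub (integrable_const 1)
  have i1 : Integrable (fun ω => ε 0 ω * g fun s => y s ω) P := ind1.integrable_mul ε1 gi
  have i2 : Integrable (fun ω => (ε 0 ω ^ 2 - 1) * k fun s => y s ω) P :=
    ind2.integrable_mul ε3 ki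
  have z1 : ∫ ω, ε 0 ω * g (fun s => y s ω) ∂P = 0 := by
    rw [ind1.integral_fun_mul_eq_mul_integral ε1.aestronglyMeasurable gi.aestronglyMeasurable,
      hε.mean 0, zero_mul]
  have z2 : ∫ ω, (ε 0 ω ^ 2 - 1) * k (fun s => y s ω) ∂P = 0 := by
    rw [ind2.integral_fun_mul_eq_mul_integral ε3.aestronglyMeasurable ki.aestronglyMeasurable,
      integral_sub ε2 (integrable_const 1), εsq]
    simp
  have hsplit : ∀ᵐ ω ∂P, bufferLoss θ (fun s => y s ω) 0 = condLoss θ θ₀ (fun s => y s ω)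
      + (ε 0 ω * g (fun s => y s ω) + (ε 0 ω ^ 2 - 1) * k fun s => y s ω) := by
    filter_upwards [hobs] with ω hω
    have hpos := hm.trans_le (hb ω)
    have hs := Real.sq_sqrt (hm.le.trans (hb₀ ω))
    change Real.log (bufferVar θ _) + (y 0 ω - bufferMean θ _) ^ 2 / bufferVar θ _ = _
    rw [hω]
    simp only [condLoss, hg, hk]
    rw [add_assoc, add_assoc]
    congr 1
    field_simp
    rw [← hs]
    simp only [Real.sqrt_sq (Real.sqrt_nonneg _)]
    ring
  have i12 : Integrable (fun ω => ε 0 ω * g (fun s => y s ω)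
      + (ε 0 ω ^ 2 - 1) * k fun s => y s ω) P := i1.add i2
  rw [integral_congr_ae hsplit, integral_add (integrable_condLoss hmom hy hm h) i12,
    integral_add i1 i2, z1, z2, add_zero, add_zero]

/-- The conditional mean losses at `θ` and at `θ₀` differ by
`(v₀ / v - 1 - log (v₀ / v)) + (μ₀ - μ)² / v`, where both terms are nonnegative, and both vanish
only if the conditional means and variances agree. -/
lemma integral_bufferLoss_lt (hls : LocationScale P y ε) (hε : IsInnovation P ε)
    (hmom : ∀ t, MemLp (y t) 2 P) {m : ℝ} (hm : 0 < m) {θ θ₀ : Param p} (h : VarBound m θ)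
    (h₀ : VarBound m θ₀) (hd : 1 ≤ θ.delay) (hd₀ : 1 ≤ θ₀.delay)
    (hLU : θ.rL ≤ θ.rU) (hLU₀ : θ₀.rL ≤ θ₀.rU) (hcoef : θ₀.coef.1.1 ≠ θ₀.coef.2.1)
    (hobs : ∀ᵐ ω ∂P, y 0 ω = bufferMean θ₀ (fun s => y s ω)
      + ε 0 ω * √(bufferVar θ₀ fun s => y s ω)) (hne : θ ≠ θ₀) :
    ∫ ω, bufferLoss θ₀ (fun s => y s ω) 0 ∂P < ∫ ω, bufferLoss θ (fun s => y s ω) 0 ∂P := by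
  have hy := hls.measurable_y
  rw [integral_bufferLoss hls hε hmom hm h h₀ hd hd₀ hobs,
    integral_bufferLoss hls hε hmom hm h₀ h₀ hd₀ hd₀ hobs]
  have i1 := integrable_condLoss (θ₀ := θ₀) hmom hy hm h
  have i2 := integrable_condLoss (θ₀ := θ₀) hmom hy hm h₀
  have hkey : ∀ x, 0 ≤ condLoss θ θ₀ x - condLoss θ₀ θ₀ x ∧
      (condLoss θ θ₀ x - condLoss θ₀ θ₀ x = 0 →
        bufferMean θ x = bufferMean θ₀ x ∧ bufferVar θ x = bufferVar θ₀ x) := by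
    intro x
    have hv := hm.trans_le (le_bufferVar hm h x)
    have hv₀ := hm.trans_le (le_bufferVar hm h₀ x)
    have hq : 0 ≤ (bufferMean θ₀ x - bufferMean θ x) ^ 2 / bufferVar θ x := by positivity
    have hl : Real.log (bufferVar θ₀ x / bufferVar θ x) =
        Real.log (bufferVar θ₀ x) - Real.log (bufferVar θ x) :=
      Real.log_div hv₀.ne' hv.ne'
    have hle := Real.log_le_sub_one_of_pos (div_pos hv₀ hv)
    have hself : condLoss θ₀ θ₀ x = Real.log (bufferVar θ₀ x) + 1 := by
      simp [condLoss, div_self hv₀.ne']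
    rw [hself, condLoss]
    refine ⟨by linarith, fun h0 => ⟨?_, ?_⟩⟩
    · have hq0 : (bufferMean θ₀ x - bufferMean θ x) ^ 2 / bufferVar θ x = 0 := by linarith
      rw [div_eq_zero_iff, or_iff_left hv.ne', sq_eq_zero_iff, sub_eq_zero] at hq0
      exact hq0.symm
    · by_contra hc
      have hlt := Real.log_lt_sub_one_of_pos (div_pos hv₀ hv) (fun h1 => hc ?_)
      · linarith
      · exact ((div_eq_one_iff_eq hv.ne').1 h1).symm
  rw [← sub_pos, ← integral_sub i1 i2]
  refine lt_of_le_of_ne (integral_nonneg fun ω => (hkey _).1) fun h0 => hne ?_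
  have hae := (integral_eq_zero_iff_of_nonneg (fun ω => (hkey _).1) (i1.sub i2)).1 h0.symm
  exact hls.eq_of_ae_eq hLU hLU₀ hcoef (hae.mono fun ω hω => ((hkey _).2 hω).1)
    (hae.mono fun ω hω => ((hkey _).2 hω).2)

end Contrast

/-! ### The parameter space -/

section ParamSpace

variable {p : ℕ} {Λ : Set (Coef p)} {a b : ℝ} {dmax : ℕ}

lemma isCompact_paramSpace (hΛ : IsCompact Λ) : IsCompact (paramSpace Λ a b dmax) := by
  have hbox : IsCompact (Λ ×ˢ Set.Icc a b ×ˢ Set.Icc a b ×ˢ Set.Icc 1 dmax) :=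
    hΛ.prod (isCompact_Icc.prod (isCompact_Icc.prod (Set.finite_Icc 1 dmax).isCompact))
  have hclosed : IsClosed {θ : Param p | θ.rL ≤ θ.rU} :=
    isClosed_le (by unfold Param.rL; fun_prop) (by unfold Param.rU; fun_prop)
  convert hbox.inter_right hclosed using 1
  ext θ
  simp only [paramSpace, Set.mem_inter_iff, Set.mem_prod, Set.mem_Icc, Set.mem_ofPred_eq,
    Param.coef, Param.rL, Param.rU, Param.delay]
  constructor
  · rintro ⟨h1, h2, h3, h4, h5, h6⟩
    exact ⟨⟨h1, ⟨h2, h3.trans h4⟩, ⟨h2.trans h3, h4⟩, h5, h6⟩, h3⟩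
  · rintro ⟨⟨h1, h2, h3, h5, h6⟩, h4⟩
    exact ⟨h1, h2.1, h4, h3.2, h5, h6⟩

/-- By compactness, the variance coefficients are bounded away from zero. -/
lemma exists_varBound (hΛ : IsCompact Λ) (hpos : ∀ l ∈ Λ, ∀ j, 0 < l.1.2 j ∧ 0 < l.2.2 j) :
    ∃ m : ℝ, 0 < m ∧ ∀ θ ∈ paramSpace Λ a b dmax, VarBound m θ := by
  rcases Λ.eq_empty_or_nonempty with rfl | hne
  · exact ⟨1, one_pos, fun θ hθ => absurd hθ.1 (Set.notMem_empty _)⟩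
  have hmin : ∀ j : Fin (p + 1), ∃ m : ℝ, 0 < m ∧ ∀ l ∈ Λ, m ≤ l.1.2 j ∧ m ≤ l.2.2 j := by
    intro j
    have hc : Continuous fun l : Coef p => min (l.1.2 j) (l.2.2 j) := by fun_prop
    obtain ⟨l₀, hl₀, hl⟩ := hΛ.exists_isMinOn hne hc.continuousOn
    exact ⟨min (l₀.1.2 j) (l₀.2.2 j), lt_min (hpos l₀ hl₀ j).1 (hpos l₀ hl₀ j).2,
      fun l h => le_min_iff.1 (hl h)⟩
  choose f hf0 hf using hmin
  refine ⟨Finset.univ.inf' Finset.univ_nonempty f, (Finset.lt_inf'_iff _).2 fun j _ => hf0 j,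
    fun θ hθ R j => (Finset.inf'_le f (Finset.mem_univ j)).trans ?_⟩
  cases R
  · exact (hf j _ hθ.1).2
  · exact (hf j _ hθ.1).1

end ParamSpace

/-! ### The process generated by the model -/

section Model

variable {p : ℕ} {Ω : Type*} [MeasurableSpace Ω] {P : Measure Ω} {y ε : ℤ → Ω → ℝ}
  {R : ℤ → Ω → Bool} {θ : Param p} {a b : ℝ}

/-- The regime indicators of the model are functions of the past of the observations. -/
lemma IsModel.ae_eq_bufferRegime (hmodel : IsModel P θ y ε R) (ha : a ≤ θ.rL) (hb : θ.rU ≤ b)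
    (hrec : ∀ᵐ ω ∂P, ∀ N : ℕ, ∃ n ≥ N, y (-(n : ℤ)) ω ∉ Set.Icc a b) :
    ∀ᵐ ω ∂P, ∀ t, R t ω = bufferRegime θ.rL θ.rU θ.delay (fun s => y s ω) t := by
  filter_upwards [hrec, ae_all_iff.2 hmodel.regime_eq] with ω h1 h2 t
  obtain ⟨n, hn, hy⟩ := h1 ((θ.delay : ℤ) - t).toNat
  exact eq_bufferRegime_of_switch (R := fun t => R t ω) (s := -(n : ℤ) + θ.delay) ha hb
    (fun t _ => h2 t) (by simpa using hy) (by omega)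

lemma IsModel.locationScale (hmodel : IsModel P θ y ε R) (hε : IsInnovation P ε) {m : ℝ}
    (hm : 0 < m) (hθ : VarBound m θ) (hd : 1 ≤ θ.delay)
    (hR : ∀ᵐ ω ∂P, ∀ t, R t ω = bufferRegime θ.rL θ.rU θ.delay (fun s => y s ω) t) :
    LocationScale P y ε where
  measurable_y := hmodel.measurable_y
  measurable_innov := hmodel.measurable_innov
  indep t := by
    have hext : Measurable fun (z : Set.Iio t → ℝ) (s : ℤ) =>
        if h : s < t then z ⟨s, h⟩ else 0 := by
      refine measurable_pi_lambda _ fun s => ?_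
      by_cases h : s < t
      · simpa only [h, dif_pos] using measurable_pi_apply (⟨s, h⟩ : Set.Iio t)
      · simp only [h, dif_neg, not_false_eq_true, measurable_const]
    exact (hmodel.indep_past t).symm.comp hext measurable_id
  law_ac t := by
    obtain ⟨f, -, -, hf⟩ := hε.density
    rw [hf t]
    exact withDensity_absolutelyContinuous _ _
  ac_law t := by
    obtain ⟨f, hfc, hfpos, hf⟩ := hε.density
    rw [hf t]
    exact withDensity_absolutelyContinuous' hfc.measurable.ennreal_ofReal.aemeasurable
      (Eventually.of_forall fun x => (ENNReal.ofReal_pos.2 (hfpos x)).ne')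
  affine t := by
    have hm1 : Measurable fun z => condMean θ (bufferRegime θ.rL θ.rU θ.delay z t) z t :=
      measurable_select (f := fun R z => condMean θ R z t) (measurable_bufferRegime _ _ _ t)
        fun _ => measurable_linMean _ t
    have hm2 : Measurable fun z => condVar θ (bufferRegime θ.rL θ.rU θ.delay z t) z t :=
      measurable_select (f := fun R z => condVar θ R z t) (measurable_bufferRegime _ _ _ t)
        fun _ => measurable_quadVar _ t
    refine ⟨_, _, hm1, hm2.sqrt,
      fun z => Real.sqrt_pos.2 (hm.trans_le (le_quadVar hm.le (hθ _) z t)), ?_⟩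
    filter_upwards [hR, hmodel.obs_eq t] with ω h1 h2
    rw [bufferRegime_congr hd fun s hs => pastPart_of_lt hs fun s => y s ω, ← h1 t, h2]
    simp only [condMean, condVar, linMean_pastPart, quadVar_pastPart]

lemma IsModel.ae_obs_zero (hmodel : IsModel P θ y ε R)
    (hR : ∀ᵐ ω ∂P, ∀ t, R t ω = bufferRegime θ.rL θ.rU θ.delay (fun s => y s ω) t) :
    ∀ᵐ ω ∂P, y 0 ω = bufferMean θ (fun s => y s ω)
      + ε 0 ω * √(bufferVar θ fun s => y s ω) := by
  filter_upwards [hR, hmodel.obs_eq 0] with ω h1 h2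
  rw [h2, h1 0]
  rfl

end Model

/-! ### Separation of the criterion and consistency -/

section Consistency

lemma sum_Icc_le_add {f g e : ℕ → ℝ} {N : ℕ} (he : ∀ t, 0 ≤ e t) (h : ∀ t, g t ≤ f t + e t)
    (h' : ∀ t ≥ N, g t ≤ f t) (n : ℕ) :
    ∑ t ∈ Finset.Icc 1 n, g t ≤ ∑ t ∈ Finset.Icc 1 n, f t + ∑ t ∈ Finset.range N, e t := by
  have h1 : ∑ t ∈ Finset.Icc 1 n, g t ≤
      ∑ t ∈ Finset.Icc 1 n, (f t + if t ∈ Finset.range N then e t else 0) := by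
    refine Finset.sum_le_sum fun t _ => ?_
    split_ifs with ht
    · exact h t
    · rw [add_zero]
      exact h' t (by simpa using ht)
  refine h1.trans ?_
  rw [Finset.sum_add_distrib, ← Finset.sum_filter]
  exact add_le_add le_rfl (Finset.sum_le_sum_of_subset_of_nonneg
    (fun t ht => (Finset.mem_filter.1 ht).2) fun t _ _ => he t)

lemma birkhoffSum_shift (f : (ℤ → ℝ) → ℝ) (n : ℕ) (x : ℤ → ℝ) :
    birkhoffSum shift f n (shift x) = ∑ t ∈ Finset.Icc 1 n, f (shift^[t] x) := by
  induction n with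
  | zero => simp
  | succ n ih =>
    rw [birkhoffSum_succ, Finset.sum_Icc_succ_top (by omega), ih, ← Function.iterate_succ_apply]

variable {p : ℕ} {Λ : Set (Coef p)} {a b : ℝ} {dmax : ℕ}

lemma sampleLoss_eq_bufferLoss_of_mem {x : ℤ → ℝ} {s : ℕ} (hs : x s ∉ Set.Icc a b)
    {θ : Param p} (hθ : θ ∈ paramSpace Λ a b dmax) {t : ℕ} (ht : s + dmax ≤ t) :
    sampleLoss x t θ = bufferLoss θ x t := by
  obtain ⟨-, h1, h2, h3, h4, h5⟩ := hθ
  refine sampleLoss_eq_bufferLoss h1 h3 (s := s + θ.delay) (by omega) ?_ (by omega)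
  simpa using hs

/-- If the minorant at `θ` has a larger mean than the loss at `θ₀`, then for almost all paths and
all large `n` no parameter near `θ` is better than `θ₀`. -/
lemma ae_eventually_criterion_lt {ν : Measure (ℤ → ℝ)} [IsProbabilityMeasure ν]
    (hν : MeasurePreserving shift ν ν) (hν' : PreErgodic shift ν)
    (hrec : ∀ᵐ x ∂ν, ∀ N : ℕ, ∃ n ≥ N, x (n : ℤ) ∉ Set.Icc a b)
    {m δ : ℝ} (hm : 0 < m) (hΘ : ∀ θ ∈ paramSpace Λ a b dmax, VarBound m θ) {θ θ₀ : Param p}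
    (hθ : θ ∈ paramSpace Λ a b dmax) (hθ₀ : θ₀ ∈ paramSpace Λ a b dmax)
    (hi : Integrable (minorant m θ δ) ν) (hi₀ : Integrable (fun x => bufferLoss θ₀ x 0) ν)
    (hlt : ∫ x, bufferLoss θ₀ x 0 ∂ν < ∫ x, minorant m θ δ x ∂ν) :
    ∀ᵐ x ∂ν, ∀ᶠ n in atTop, ∀ θ' ∈ paramSpace Λ a b dmax, Near δ θ θ' →
      criterion x n θ₀ < criterion x n θ' := by
  obtain ⟨c, hc₀, hc⟩ := exists_between hlt
  have e1 := hν.quasiMeasurePreserving.ae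
    (ae_eventually_lt_birkhoffSum hν hν' (measurable_minorant m θ δ) hi hc)
  have e2 := hν.quasiMeasurePreserving.ae
    (ae_eventually_birkhoffSum_lt hν hν' (measurable_bufferLoss θ₀) hi₀ hc₀)
  filter_upwards [e1, e2, hrec] with x h1 h2 h3
  obtain ⟨s, -, hs⟩ := h3 0
  -- the finitely many losses before time `s + dmax` contribute at most a constant
  filter_upwards [h1 (∑ t ∈ Finset.range (s + dmax),
      (|minorant m θ δ (shift^[t] x)| + |Real.log m|)),
    h2 (∑ t ∈ Finset.range (s + dmax),
      |sampleLoss x t θ₀ - bufferLoss θ₀ (shift^[t] x) 0|)] with n hn₁ hn₂ θ' hθ' hnear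
  rw [birkhoffSum_shift] at hn₁ hn₂
  have k1 : ∑ t ∈ Finset.Icc 1 n, minorant m θ δ (shift^[t] x) ≤ criterion x n θ' +
      ∑ t ∈ Finset.range (s + dmax), (|minorant m θ δ (shift^[t] x)| + |Real.log m|) := by
    refine sum_Icc_le_add (fun t => by positivity) (fun t => ?_) (fun t ht => ?_) n
    · have := log_le_sampleLoss hm (hΘ θ' hθ') x t
      linarith [le_abs_self (minorant m θ δ (shift^[t] x)), neg_abs_le (Real.log m)]
    · rw [sampleLoss_eq_bufferLoss_of_mem hs hθ' ht, ← bufferLoss_shift_iterate]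
      exact minorant_le hm (hΘ θ hθ) (hΘ θ' hθ') hnear _
  have k2 : criterion x n θ₀ ≤ ∑ t ∈ Finset.Icc 1 n, bufferLoss θ₀ (shift^[t] x) 0 +
      ∑ t ∈ Finset.range (s + dmax), |sampleLoss x t θ₀ - bufferLoss θ₀ (shift^[t] x) 0| := by
    refine sum_Icc_le_add (fun t => abs_nonneg _) (fun t => ?_) (fun t ht => ?_) n
    · linarith [le_abs_self (sampleLoss x t θ₀ - bufferLoss θ₀ (shift^[t] x) 0)]
    · rw [sampleLoss_eq_bufferLoss_of_mem hs hθ₀ ht, bufferLoss_shift_iterate]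
  linarith

/-- Points of a compact set converge to `x₀` if they eventually avoid some neighbourhood of every
other point of the set. -/
lemma tendsto_of_eventually_avoid {X : Type*} [TopologicalSpace X] {K : Set X} (hK : IsCompact K)
    {u : ℕ → X} (hu : ∀ n, u n ∈ K) {x₀ : X}
    (h : ∀ x ∈ K, x ≠ x₀ → ∃ V ∈ 𝓝 x, ∀ᶠ n in atTop, u n ∉ V) : Tendsto u atTop (𝓝 x₀) := by
  refine hK.tendsto_nhds_of_unique_mapClusterPt (Eventually.of_forall hu) fun x hx hcl => ?_
  by_contra hne
  obtain ⟨V, hV, hev⟩ := h x hx hne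
  exact (mapClusterPt_iff_frequently.1 hcl V hV) hev

end Consistency

end BDAR

theorem theorem2 {Ω : Type*} [MeasurableSpace Ω] (P : Measure Ω) [IsProbabilityMeasure P]
    (p : ℕ) (Λ : Set (BDAR.Coef p)) (a b : ℝ) (dmax : ℕ)
    (y ε : ℤ → Ω → ℝ) (R : ℤ → Ω → Bool) (θ₀ : BDAR.Param p)
    -- the true parameter lies in the parameter space and generates the process
    (hθ₀ : θ₀ ∈ BDAR.paramSpace Λ a b dmax)
    (hmodel : BDAR.IsModel P θ₀ y ε R)
    -- first assumption
    (hab : ∀ t, P {ω | y t ω ∈ Set.Icc a b} < 1)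
    (hε : BDAR.IsInnovation P ε)
    -- second assumption
    (hΛ : IsCompact Λ)
    (hne : ∀ l ∈ Λ, l.1.1 ≠ l.2.1 ∧ l.1.2 ≠ l.2.2)
    (hpos : ∀ l ∈ Λ, ∀ j, 0 < l.1.2 j ∧ 0 < l.2.2 j)
    -- stationarity, ergodicity and the second moment
    (hstat : BDAR.StrictlyStationary P y)
    (herg : BDAR.IsErgodic P y)
    (hmom : ∀ t, MemLp (y t) 2 P)
    -- any choice of the estimator
    (θhat : ℕ → Ω → BDAR.Param p)
    (hθhat : ∀ n, ∀ᵐ ω ∂P,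
      BDAR.IsQMLE (BDAR.paramSpace Λ a b dmax) (fun t => y t ω) n (θhat n ω)) :
    ∀ᵐ ω ∂P, Tendsto (fun n => θhat n ω) atTop (𝓝 θ₀) := by
  obtain ⟨m, hm, hΘ⟩ := BDAR.exists_varBound (a := a) (b := b) (dmax := dmax) hΛ hpos
  have hpath : Measurable fun ω (t : ℤ) => y t ω := measurable_pi_lambda _ hmodel.measurable_y
  have hprob : IsProbabilityMeasure (BDAR.pathLaw P y) :=
    Measure.isProbabilityMeasure_map hpath.aemeasurable
  have hcoord : BDAR.pathLaw P y {x | x 0 ∈ Set.Icc a b} < 1 := by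
    have hm0 : MeasurableSet {x : ℤ → ℝ | x 0 ∈ Set.Icc a b} :=
      measurable_pi_apply 0 measurableSet_Icc
    rw [BDAR.pathLaw, Measure.map_apply hpath hm0]
    exact hab 0
  have hfut := BDAR.ae_exists_notMem hstat herg measurableSet_Icc hcoord (u := fun n => (n : ℤ))
    (Or.inl fun n => by push_cast; rfl)
  have hpast := BDAR.ae_exists_notMem hstat herg measurableSet_Icc hcoord
    (u := fun n => -(n : ℤ)) (Or.inr fun n => by push_cast; ring)
  have hrec := ae_of_ae_map hpath.aemeasurable hpast
  have hR := hmodel.ae_eq_bufferRegime hθ₀.2.1 hθ₀.2.2.2.1 hrec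
  have hls := hmodel.locationScale hε hm (hΘ θ₀ hθ₀) hθ₀.2.2.2.2.1 hR
  have hobs := hmodel.ae_obs_zero hR
  have hsep : ∀ θ ∈ BDAR.paramSpace Λ a b dmax \ {θ₀}, ∃ V ∈ 𝓝 θ, ∀ᵐ ω ∂P, ∀ᶠ n in atTop,
      ∀ θ' ∈ BDAR.paramSpace Λ a b dmax, θ' ∈ V →
        BDAR.criterion (fun t => y t ω) n θ₀ < BDAR.criterion (fun t => y t ω) n θ' := by
    rintro θ ⟨hθ, hθne⟩
    have hlt := BDAR.integral_bufferLoss_lt hls hε hmom hm (hΘ θ hθ) (hΘ θ₀ hθ₀)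
      hθ.2.2.2.2.1 hθ₀.2.2.2.2.1 hθ.2.2.1 hθ₀.2.2.1 (hne _ hθ₀.1).1 hobs hθne
    obtain ⟨k, hk⟩ := ((BDAR.tendsto_integral_minorant hls hmom hm (hΘ θ hθ) hθ.2.1
      hθ.2.2.2.1 hrec).eventually_const_lt hlt).exists
    have hδ0 : (0 : ℝ) < 1 / ((k : ℝ) + 1) := by positivity
    have hδ1 : 1 / ((k : ℝ) + 1) ≤ 1 := by
      rw [div_le_one (by positivity)]
      linarith [(Nat.cast_nonneg k : (0 : ℝ) ≤ k)]
    have hmeas := BDAR.measurable_minorant m θ (1 / ((k : ℝ) + 1))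
    have hmeas₀ := BDAR.measurable_bufferLoss θ₀
    refine ⟨_, BDAR.eventually_near θ hδ0, ae_of_ae_map hpath.aemeasurable
      (BDAR.ae_eventually_criterion_lt hstat herg hfut hm hΘ hθ hθ₀ ?_ ?_ ?_)⟩
    · exact (integrable_map_measure hmeas.aestronglyMeasurable hpath.aemeasurable).2
        (BDAR.integrable_minorant hmom hmodel.measurable_y hm hδ0.le hδ1 (hΘ θ hθ))
    · exact (integrable_map_measure hmeas₀.aestronglyMeasurable hpath.aemeasurable).2
        (BDAR.integrable_bufferLoss hmom hmodel.measurable_y hm (hΘ θ₀ hθ₀))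
    · rw [BDAR.pathLaw, integral_map hpath.aemeasurable hmeas₀.aestronglyMeasurable,
        integral_map hpath.aemeasurable hmeas.aestronglyMeasurable]
      exact hk
  choose! V hV hVae using hsep
  -- countably many of these neighbourhoods suffice, so that one null set serves all of them
  obtain ⟨T, hTs, hTc, hcover⟩ := TopologicalSpace.countable_cover_nhdsWithin
    (fun θ hθ => mem_nhdsWithin_of_mem_nhds (interior_mem_nhds.2 (hV θ hθ)))
  have hall := (ae_ball_iff hTc).2 fun θ hθ => hVae θ (hTs hθ)
  filter_upwards [hall, ae_all_iff.2 hθhat] with ω h1 h2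
  refine BDAR.tendsto_of_eventually_avoid (BDAR.isCompact_paramSpace hΛ) (fun n => (h2 n).1)
    fun θ hθ hθne => ?_
  obtain ⟨θ₁, hθ₁, hmem⟩ := Set.mem_iUnion₂.1 (hcover ⟨hθ, hθne⟩)
  refine ⟨V θ₁, mem_interior_iff_mem_nhds.1 hmem, ?_⟩
  filter_upwards [h1 θ₁ hθ₁] with n hn hmemV
  exact (hn _ (h2 n).1 hmemV).not_ge ((h2 n).2 hθ₀)
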